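/- For $n\ge 1$, real-valued functions $F_1,\dots,F_n$ on $\mathbb R$ and $k,x\in\mathbb R$ let $$T_n(F_1,\dots,F_n)(k,x)=\int_{x_1<\dots<x_n<x}e^{-2ik\sum_{j=1}^n(-1)^jx_j}F_1(x_1)\cdots F_n(x_n)\,dx_1\cdots dx_n ,$$ and let $T_n(F_1,\dots,F_n)(k,+\infty)$ be the same integral over $x_1<\dots<x_n$. Let $\|g\|_{L^{q,\infty}}=\sup_{t>0}t\,|\{k:|g(k)|>t\}|^{1/q}$. **Theorem.** (i) There is no constant $C$ such that $$\Big\|\sup_{x\in\mathbb R}|T_2(F,F)(k,x)|\Big\|_{L^{1,\infty}_k}\le C\,\|F\|_{L^2}^2$$ for all $F$; the estimate fails even if it is only required for real-valued $F\in C_c^\infty((0,\infty))$. (ii) There is no constant $C$ such that $$\|T_3(F,F,F)(k,+\infty)\|_{L^{2/3,\infty}_k}\le C\,\|F\|_{L^2}^3$$ for all $F$; again this fails even if it is only required for real-valued $F\in C_c^\infty((0,\infty))$. (iii) Both failures are witnessed, with a logarithmic divergence, by explicit chirps. There exist smooth $\phi:\mathbb R\to\mathbb R$, supported in $[-\frac14,\frac14]$,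 with $\int\phi=1$ and $\int e^{-2i\xi x}\phi(x)\,dx\ne0$ for all $\xi\in[-1,1]$. For each such $\phi$ there is $A_0$ such that for every $A\ge A_0$ there are $c>0$, $C<\infty$ and $N_0$ such that for all integers $N\ge N_0$ the function $$F(x)=\sum_{j=N}^{2N}N^{-1}\cos\Big(2\frac{Aj}{N}x\Big)\,\phi\Big(\frac xN-j\Big)$$ satisfies $\|F\|_{L^2}\le C$, while each of the sets $$\Big\{k\in[A,2A]:\ \sup_{x}|T_2(F,F)(k,x)|\ge c\log N\Big\},\qquad \Big\{k\in[A,2A]:\ |T_3(F,F,F)(k,+\infty)|\ge c\log N\Big\}$$ has Lebesgue measure at least $\frac14$. -/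

import Mathlib

open MeasureTheory
open scoped ContDiff

namespace ChristKiselev

noncomputable section

/-- The integrand `e^{-2ik ∑_{j=1}^n (-1)^j y_j} F_1(y_1) ⋯ F_n(y_n)`. The index `i : Fin n`
stands for `j = i + 1`. -/
def integrand {n : ℕ} (F : Fin n → ℝ → ℝ) (k : ℝ) (y : Fin n → ℝ) : ℂ :=
  Complex.exp (-2 * Complex.I * (k : ℂ) * ((∑ i : Fin n, (-1) ^ ((i : ℕ) + 1) * y i : ℝ) : ℂ)) *
    ((∏ i : Fin n, F i (y i) : ℝ) : ℂ)

/-- `T_n(F_1, …, F_n)(k, x)`: the integral over the simplex `y_1 < ⋯ < y_n < x`. -/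
def T {n : ℕ} (F : Fin n → ℝ → ℝ) (k x : ℝ) : ℂ :=
  ∫ y in {y : Fin n → ℝ | StrictMono y ∧ ∀ i, y i < x}, integrand F k y

/-- `T_n(F_1, …, F_n)(k, +∞)`: the integral over the unbounded simplex `y_1 < ⋯ < y_n`. -/
def TInfty {n : ℕ} (F : Fin n → ℝ → ℝ) (k : ℝ) : ℂ :=
  ∫ y in {y : Fin n → ℝ | StrictMono y}, integrand F k y

/-- The weak Lebesgue quasi-norm `‖g‖_{L^{q,∞}(ℝ)} = sup_{t>0} t |{k : g(k) > t}|^{1/q}`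
of a nonnegative function `g`, for `0 < q < ∞`. -/
def weakNorm (q : ℝ) (g : ℝ → ENNReal) : ENNReal :=
  ⨆ t : NNReal, (t : ENNReal) * volume {k : ℝ | (t : ENNReal) < g k} ^ (1 / q)

/-- The maximal function `k ↦ sup_x |T_n(F, …, F)(k, x)|`, with values in `[0, ∞]`. -/
def maximalT (n : ℕ) (F : ℝ → ℝ) (k : ℝ) : ENNReal :=
  ⨆ x : ℝ, ‖T (fun _ : Fin n => F) k x‖ₑ

/-- The Fourier transform in the normalization `∫ e^{-2iξx} φ(x) dx`. -/
def fourierTwo (φ : ℝ → ℝ) (ξ : ℝ) : ℂ :=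
  ∫ x : ℝ, Complex.exp (-2 * Complex.I * (ξ : ℂ) * (x : ℂ)) * (φ x : ℂ)

/-- Admissible bumps: smooth, real-valued, supported in `[-1/4, 1/4]`, of total mass one, with
Fourier transform nonvanishing (hence, by continuity, bounded away from zero) on `[-1, 1]`. -/
structure IsBump (φ : ℝ → ℝ) : Prop where
  smooth : ContDiff ℝ ∞ φ
  support_subset : Function.support φ ⊆ Set.Icc (-(1 / 4)) (1 / 4)
  integral_eq_one : ∫ x : ℝ, φ x = 1
  fourier_ne_zero : ∀ ξ ∈ Set.Icc (-1 : ℝ) 1, fourierTwo φ ξ ≠ 0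

/-- The chirp `F(x) = ∑_{j=N}^{2N} N⁻¹ cos(2 (A j / N) x) φ(x / N - j)`. -/
def chirp (φ : ℝ → ℝ) (A : ℝ) (N : ℕ) (x : ℝ) : ℝ :=
  ∑ j ∈ Finset.Icc N (2 * N),
    (N : ℝ)⁻¹ * Real.cos (2 * (A * (j : ℝ) / (N : ℝ)) * x) * φ (x / (N : ℝ) - (j : ℝ))

end

end ChristKiselev

/-! The chirp has size `1/N` on an interval of length about `N²`, so its `L²` norm stays bounded. It
is cut into blocks `i = 0, …, N`, one for each `j = N + i`. After modulation by `e^{2ikx}` and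
rescaling to `[-1/2, 1/2]`, each block is `φ` times two oscillations of frequencies `ξ_i = Nk -
A(N+i)` and `η_i = Nk + A(N+i)`. The `η_i` are at least `NA` and contribute only errors. If `k` is
within `1/N` of `A(N+m)/N`, then `|ξ_m| ≤ 1`, while `|ξ_i|` is comparable to `A|i - m|` for `i ≠ m`.

Let `p_i`, `t_i`, `s_i` be the iterated integrals of orders one, two and three over block `i`.
Integration by parts makes `p_i` and `s_i` summable away from `m`, but leaves `t_i ≈ κ/(√-1 ξ_i)`
with `κ = ∫φ²/8`, because a block paired with its own conjugate produces a non-oscillating term.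
Since `ξ_i` is positive before `m` and negative after it, stopping the second order integral at the
left end of block `m` gives a one-signed harmonic sum of size `log m` (`le_norm_Q`).

At third order, Chen's identity assembles the whole integral from the blocks. Its main part is `p_m
(∑_{i<m} t_i + ∑_{i>m} conj t_i)`. Conjugation undoes the sign change of `ξ_i`, so the two sides
reinforce each other and no truncation is needed (`le_norm_S`). The nonvanishing transform of `φ` on
`[-1, 1]` keeps `p_m` away from zero. A large `A` makes the total of the other `p_i` small, which
matters because it too multiplies a logarithm.

The resonant `k` with `m ≥ N/2` fill a fixed proportion of `[A, 2A]` (`le_volume_of_resonant`).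
There `log m` differs from `log N` by at most a constant, and both weak-type bounds fail as `N → ∞`.
-/

namespace ChristKiselev

/-! ### Simplex integrals as nested one-dimensional integrals -/

/-- The integrand is integrable for continuous factors with compact support. -/
theorem integrable_integrand {n : ℕ} {F : Fin n → ℝ → ℝ} (hF : ∀ i, Continuous (F i))
    (hc : ∀ i, HasCompactSupport (F i)) (k : ℝ) : Integrable (integrand F k) := by
  have h1 : Integrable (fun y : Fin n → ℝ => ((∏ i : Fin n, F i (y i) : ℝ) : ℂ)) :=
    (Integrable.fintype_prod (f := F) (μ := fun _ => volume)
      fun i => (hF i).integrable_of_hasCompactSupport (hc i)).ofReal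
  refine h1.bdd_mul (c := 1) (Continuous.aestronglyMeasurable (by fun_prop)) ?_
  refine Filter.Eventually.of_forall fun y => ?_
  rw [show ∀ r : ℝ, -2 * Complex.I * (k : ℂ) * (r : ℂ) = ((-2 * k * r : ℝ) : ℂ) * Complex.I from
    fun r => by push_cast; ring, Complex.norm_exp_ofReal_mul_I]

theorem measurableSet_simplex (n : ℕ) (x : ℝ) :
    MeasurableSet {y : Fin n → ℝ | StrictMono y ∧ ∀ i, y i < x} := by
  have : {y : Fin n → ℝ | StrictMono y ∧ ∀ i, y i < x} =
      (⋂ i, ⋂ j, ⋂ (_ : i < j), {y : Fin n → ℝ | y i < y j}) ∩ ⋂ i, {y : Fin n → ℝ | y i < x} := by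
    ext y; simp [StrictMono]
  rw [this]
  refine MeasurableSet.inter ?_ ?_
  · exact MeasurableSet.iInter fun i => MeasurableSet.iInter fun j => MeasurableSet.iInter fun _ =>
      measurableSet_lt (measurable_pi_apply i) (measurable_pi_apply j)
  · exact MeasurableSet.iInter fun i => measurableSet_lt (measurable_pi_apply i) measurable_const

/-- The simplex is fibred over its largest coordinate, which becomes the upper limit for the
remaining ones. This is the recursion behind `T_succ`. -/
theorem snoc_mem_simplex_iff {n : ℕ} (z : Fin n → ℝ) (u x : ℝ) :
    (StrictMono (Fin.snoc z u : Fin (n + 1) → ℝ) ∧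
      ∀ i, (Fin.snoc z u : Fin (n + 1) → ℝ) i < x) ↔
      u < x ∧ (StrictMono z ∧ ∀ i, z i < u) := by
  constructor
  · rintro ⟨h1, h2⟩
    refine ⟨by simpa using h2 (Fin.last n), fun i j hij => ?_, fun i => ?_⟩
    · simpa using h1 (Fin.castSucc_lt_castSucc_iff.2 hij)
    · simpa using h1 (Fin.castSucc_lt_last i)
  · rintro ⟨hu, hz, hzu⟩
    refine ⟨fun i j => ?_, fun i => ?_⟩
    · refine Fin.lastCases ?_ (fun j => ?_) j
      · refine Fin.lastCases (fun h => absurd h (lt_irrefl _)) (fun i _ => ?_) i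
        simpa using hzu i
      · refine Fin.lastCases (fun h => absurd h (not_lt.2 (Fin.le_last _))) (fun i h => ?_) i
        simpa using hz (Fin.castSucc_lt_castSucc_iff.1 h)
    · refine Fin.lastCases ?_ (fun i => ?_) i
      · simpa using hu
      · simpa using (hzu i).trans hu

theorem integrand_snoc {n : ℕ} (F : Fin (n + 1) → ℝ → ℝ) (k : ℝ) (z : Fin n → ℝ) (u : ℝ) :
    integrand F k (Fin.snoc z u : Fin (n + 1) → ℝ) =
      Complex.exp (-2 * Complex.I * (k : ℂ) * ((-1) ^ (n + 1) * (u : ℂ))) * (F (Fin.last n) u : ℂ) *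
        integrand (fun i => F i.castSucc) k z := by
  unfold integrand
  rw [Fin.sum_univ_castSucc, Fin.prod_univ_castSucc]
  simp only [Fin.snoc_castSucc, Fin.snoc_last, Fin.val_castSucc, Fin.val_last]
  push_cast
  rw [mul_add, Complex.exp_add]
  ring

theorem T_zero (F : Fin 0 → ℝ → ℝ) (k x : ℝ) : T F k x = 1 := by
  unfold T
  have : {y : Fin 0 → ℝ | StrictMono y ∧ ∀ i, y i < x} = Set.univ := by
    ext y; simp [Subsingleton.strictMono]
  rw [this, Measure.restrict_univ, Measure.volume_pi_eq_dirac, integral_dirac]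
  simp [integrand]

/-- Integrating out the largest variable. -/
theorem T_succ {n : ℕ} {F : Fin (n + 1) → ℝ → ℝ} (hF : ∀ i, Continuous (F i))
    (hc : ∀ i, HasCompactSupport (F i)) (k x : ℝ) :
    T F k x = ∫ u in Set.Iio x,
      Complex.exp (-2 * Complex.I * (k : ℂ) * ((-1) ^ (n + 1) * (u : ℂ))) *
        (F (Fin.last n) u : ℂ) * T (fun i => F i.castSucc) k u := by
  have hmp := (volume_preserving_piFinSuccAbove (fun _ : Fin (n + 1) => ℝ) (Fin.last n)).symm
  have hi : Integrable ({y : Fin (n + 1) → ℝ | StrictMono y ∧ ∀ i, y i < x}.indicator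
      (integrand F k)) :=
    (integrable_integrand hF hc k).indicator (measurableSet_simplex _ _)
  have hi' := (hmp.integrable_comp_emb
    (MeasurableEquiv.measurableEmbedding _)).2 hi
  unfold T
  rw [← integral_indicator (measurableSet_simplex _ _),
    ← hmp.integral_comp (MeasurableEquiv.measurableEmbedding _)]
  rw [Measure.volume_eq_prod, integral_prod _ (by rwa [Measure.volume_eq_prod] at hi'),
    ← integral_indicator measurableSet_Iio]
  refine integral_congr_ae (Filter.Eventually.of_forall fun u => ?_)
  have key : ∀ z : Fin n → ℝ,
      (MeasurableEquiv.piFinSuccAbove (fun _ : Fin (n + 1) => ℝ) (Fin.last n)).symm (u, z) =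
        (Fin.snoc z u : Fin (n + 1) → ℝ) := fun z => by
    simp [MeasurableEquiv.piFinSuccAbove, Fin.insertNthEquiv, Fin.insertNth_last']
  simp only [key]
  by_cases hu : u < x
  · rw [Set.indicator_of_mem (show u ∈ Set.Iio x from hu), ← integral_const_mul,
      ← integral_indicator (measurableSet_simplex _ _)]
    refine integral_congr_ae (Filter.Eventually.of_forall fun z => ?_)
    simp only [Set.indicator_apply, Set.mem_ofPred_eq, snoc_mem_simplex_iff, hu, true_and,
      integrand_snoc]
  · rw [Set.indicator_of_notMem (show u ∉ Set.Iio x from hu)]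
    simp [snoc_mem_simplex_iff, hu]

/-- For factors vanishing beyond `x` the integral over the unbounded simplex stops at `x`. -/
theorem TInfty_eq_T {n : ℕ} {F : Fin n → ℝ → ℝ} {x : ℝ} (hx : ∀ i, ∀ t, x ≤ t → F i t = 0)
    (k : ℝ) : TInfty F k = T F k x := by
  unfold T TInfty
  refine setIntegral_eq_of_subset_of_forall_sdiff_eq_zero ?_ (fun y hy => hy.1) ?_
  · have : {y : Fin n → ℝ | StrictMono y} =
        ⋂ i, ⋂ j, ⋂ (_ : i < j), {y : Fin n → ℝ | y i < y j} := by
      ext y; simp [StrictMono]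
    rw [this]
    exact MeasurableSet.iInter fun i => MeasurableSet.iInter fun j => MeasurableSet.iInter fun _ =>
      measurableSet_lt (measurable_pi_apply i) (measurable_pi_apply j)
  · rintro y ⟨hy, hy'⟩
    have : ∃ i, x ≤ y i := by
      by_contra! h
      exact hy' ⟨hy, h⟩
    obtain ⟨i, hi⟩ := this
    have : ∏ i, F i (y i) = 0 := Finset.prod_eq_zero (Finset.mem_univ i) (hx i _ hi)
    simp [integrand, this]

theorem setIntegral_Iio_eq_intervalIntegral {f : ℝ → ℂ} {a x : ℝ} (hax : a ≤ x)
    (hf : ∀ t ≤ a, f t = 0) : ∫ u in Set.Iio x, f u = ∫ u in a..x, f u := by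
  rw [intervalIntegral.integral_of_le hax, ← integral_Iic_eq_integral_Iio]
  refine setIntegral_eq_of_subset_of_forall_sdiff_eq_zero measurableSet_Iic
    Set.Ioc_subset_Iic_self ?_
  rintro t ⟨ht, ht'⟩
  refine hf t ?_
  by_contra! h
  exact ht' ⟨h, ht⟩

/-! ### Iterated integrals: Chen's identity, rescaling, conjugation -/

/-- The double iterated integral `∫_{a<s<t<x} f(s) g(t)`. -/
noncomputable def iterTwo (f g : ℝ → ℂ) (a x : ℝ) : ℂ :=
  ∫ t in a..x, g t * ∫ s in a..t, f s

/-- The triple iterated integral `∫_{a<r<s<t<x} f(r) g(s) h(t)`. -/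
noncomputable def iterThree (f g h : ℝ → ℂ) (a x : ℝ) : ℂ :=
  ∫ t in a..x, h t * iterTwo f g a t

theorem continuous_primitive {f : ℝ → ℂ} (hf : Continuous f) (a : ℝ) :
    Continuous fun x => ∫ t in a..x, f t :=
  intervalIntegral.continuous_primitive (fun _ _ => hf.intervalIntegrable _ _) a

theorem continuous_iterTwo {f g : ℝ → ℂ} (hf : Continuous f) (hg : Continuous g) (a : ℝ) :
    Continuous (iterTwo f g a) :=
  continuous_primitive (hg.mul (continuous_primitive hf a)) a

/-- The region `a < s < t < c` splits by the position of `b`: above both variables, between them, or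
below both. The middle case factors. -/
theorem iterTwo_chen {f g : ℝ → ℂ} (hf : Continuous f) (hg : Continuous g) (a b c : ℝ) :
    iterTwo f g a c = iterTwo f g a b + (∫ t in a..b, f t) * (∫ t in b..c, g t) +
      iterTwo f g b c := by
  have hi : ∀ d, Continuous fun t => g t * ∫ s in d..t, f s := fun d =>
    hg.mul (continuous_primitive hf d)
  have h1 : iterTwo f g a c = iterTwo f g a b + ∫ t in b..c, g t * ∫ s in a..t, f s :=
    (intervalIntegral.integral_add_adjacent_intervals ((hi a).intervalIntegrable _ _)
      ((hi a).intervalIntegrable _ _)).symm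
  rw [h1, add_assoc]
  congr 1
  rw [← intervalIntegral.integral_const_mul]
  unfold iterTwo
  have hg' : Continuous fun t => (∫ s in a..b, f s) * g t := continuous_const.mul hg
  rw [← intervalIntegral.integral_add (hg'.intervalIntegrable _ _)
    ((hi b).intervalIntegrable _ _)]
  refine intervalIntegral.integral_congr fun t _ => ?_
  rw [← intervalIntegral.integral_add_adjacent_intervals (hf.intervalIntegrable a b)
    (hf.intervalIntegrable b t)]
  ring

/-- Now `b` has four possible positions among three ordered variables. Each mixed case is a product
of integrals of lower order. -/
theorem iterThree_chen {f g h : ℝ → ℂ} (hf : Continuous f) (hg : Continuous g)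
    (hh : Continuous h) (a b c : ℝ) :
    iterThree f g h a c = iterThree f g h a b + iterTwo f g a b * (∫ t in b..c, h t) +
      (∫ t in a..b, f t) * iterTwo g h b c + iterThree f g h b c := by
  have hi : ∀ d, Continuous fun t => h t * iterTwo f g d t := fun d =>
    hh.mul (continuous_iterTwo hf hg d)
  have h1 : iterThree f g h a c = iterThree f g h a b + ∫ t in b..c, h t * iterTwo f g a t :=
    (intervalIntegral.integral_add_adjacent_intervals ((hi a).intervalIntegrable _ _)
      ((hi a).intervalIntegrable _ _)).symm
  have hgh : Continuous fun t => h t * ∫ s in b..t, g s := hh.mul (continuous_primitive hg b)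
  have hgh' : Continuous fun t => (∫ s in a..b, f s) * (h t * ∫ s in b..t, g s) :=
    continuous_const.mul hgh
  have hh' : Continuous fun t => iterTwo f g a b * h t := continuous_const.mul hh
  have hs : Continuous fun t => (∫ s in a..b, f s) * (h t * ∫ s in b..t, g s) +
      h t * iterTwo f g b t := hgh'.add (hi b)
  rw [h1, add_assoc, add_assoc]
  congr 1
  unfold iterThree
  rw [show iterTwo g h b c = ∫ t in b..c, h t * ∫ s in b..t, g s from rfl,
    ← intervalIntegral.integral_const_mul, ← intervalIntegral.integral_const_mul,
    ← intervalIntegral.integral_add (hgh'.intervalIntegrable _ _)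
    ((hi b).intervalIntegrable _ _),
    ← intervalIntegral.integral_add (hh'.intervalIntegrable _ _)
    (hs.intervalIntegrable _ _)]
  refine intervalIntegral.integral_congr fun t _ => ?_
  rw [iterTwo_chen hf hg a b t]
  ring

theorem integral_affine (f : ℝ → ℂ) {c : ℝ} (hc : c ≠ 0) (d a u : ℝ) :
    ∫ t in c * a + d..c * u + d, f t = ∫ s in a..u, (c : ℂ) * f (c * s + d) := by
  rw [intervalIntegral.integral_const_mul, intervalIntegral.integral_comp_mul_add _ hc]
  simp [hc]

theorem iterTwo_affine (f g : ℝ → ℂ) {c : ℝ} (hc : c ≠ 0) (d a u : ℝ) :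
    iterTwo f g (c * a + d) (c * u + d) =
      iterTwo (fun s => (c : ℂ) * f (c * s + d)) (fun s => (c : ℂ) * g (c * s + d)) a u := by
  unfold iterTwo
  rw [integral_affine _ hc]
  refine intervalIntegral.integral_congr fun t _ => ?_
  simp only
  rw [integral_affine _ hc]
  ring

theorem iterThree_affine (f g h : ℝ → ℂ) {c : ℝ} (hc : c ≠ 0) (d a u : ℝ) :
    iterThree f g h (c * a + d) (c * u + d) =
      iterThree (fun s => (c : ℂ) * f (c * s + d)) (fun s => (c : ℂ) * g (c * s + d))
        (fun s => (c : ℂ) * h (c * s + d)) a u := by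
  unfold iterThree
  rw [integral_affine _ hc]
  refine intervalIntegral.integral_congr fun t _ => ?_
  simp only
  rw [iterTwo_affine _ _ hc]
  ring

theorem integral_star (f : ℝ → ℂ) (a x : ℝ) :
    ∫ t in a..x, star (f t) = star (∫ t in a..x, f t) := by
  simp only [intervalIntegral, star_sub]
  have h : ∀ s : Set ℝ, ∫ t in s, star (f t) = star (∫ t in s, f t) := fun s => integral_conj
  rw [h, h]

theorem iterTwo_star (f g : ℝ → ℂ) (a x : ℝ) :
    iterTwo (fun t => star (f t)) (fun t => star (g t)) a x = star (iterTwo f g a x) := by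
  unfold iterTwo
  rw [← integral_star]
  refine intervalIntegral.integral_congr fun t _ => ?_
  simp only
  rw [integral_star, star_mul']

/-! ### The operators `T_1`, `T_2`, `T_3` in terms of the modulated function -/

/-- The modulated function `t ↦ e^{2ikt} F(t)`. -/
noncomputable def modulate (k : ℝ) (F : ℝ → ℝ) (t : ℝ) : ℂ :=
  Complex.exp (2 * Complex.I * (k : ℂ) * (t : ℂ)) * (F t : ℂ)

theorem continuous_modulate (k : ℝ) {F : ℝ → ℝ} (hF : Continuous F) :
    Continuous (modulate k F) := by
  unfold modulate; fun_prop

theorem star_modulate (k : ℝ) (F : ℝ → ℝ) (t : ℝ) :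
    star (modulate k F t) = Complex.exp (-2 * Complex.I * (k : ℂ) * (t : ℂ)) * (F t : ℂ) := by
  unfold modulate
  rw [star_mul']
  simp [← Complex.exp_conj, Complex.conj_ofNat]

theorem T_one_eq {F : ℝ → ℝ} (hF : Continuous F) (hc : HasCompactSupport F) {a x : ℝ}
    (ha : ∀ t ≤ a, F t = 0) (hax : a ≤ x) (k : ℝ) :
    T (fun _ : Fin 1 => F) k x = ∫ t in a..x, modulate k F t := by
  rw [T_succ (fun _ => hF) (fun _ => hc),
    setIntegral_Iio_eq_intervalIntegral hax (fun t ht => by simp [ha t ht])]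
  refine intervalIntegral.integral_congr fun t _ => ?_
  simp [T_zero, modulate]

/-- The alternating sign of the phase turns every second factor into the complex conjugate of
`modulate k F`, because `F` is real. -/
theorem T_two_eq {F : ℝ → ℝ} (hF : Continuous F) (hc : HasCompactSupport F) {a x : ℝ}
    (ha : ∀ t ≤ a, F t = 0) (hax : a ≤ x) (k : ℝ) :
    T (fun _ : Fin 2 => F) k x =
      iterTwo (modulate k F) (fun t => star (modulate k F t)) a x := by
  rw [T_succ (fun _ => hF) (fun _ => hc),
    setIntegral_Iio_eq_intervalIntegral hax (fun t ht => by simp [ha t ht])]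
  refine intervalIntegral.integral_congr fun t ht => ?_
  rw [Set.uIcc_of_le hax] at ht
  simp only [T_one_eq hF hc ha ht.1, star_modulate]
  norm_num

theorem T_three_eq {F : ℝ → ℝ} (hF : Continuous F) (hc : HasCompactSupport F) {a x : ℝ}
    (ha : ∀ t ≤ a, F t = 0) (hax : a ≤ x) (k : ℝ) :
    T (fun _ : Fin 3 => F) k x =
      iterThree (modulate k F) (fun t => star (modulate k F t)) (modulate k F) a x := by
  rw [T_succ (fun _ => hF) (fun _ => hc),
    setIntegral_Iio_eq_intervalIntegral hax (fun t ht => by simp [ha t ht])]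
  refine intervalIntegral.integral_congr fun t ht => ?_
  rw [Set.uIcc_of_le hax] at ht
  simp only [T_two_eq hF hc ha ht.1, modulate]
  norm_num [pow_succ]

/-! ### Oscillatory primitives of a profile -/

/-- The pure oscillation `s ↦ e^{2iζs}`. -/
noncomputable def osc (ζ s : ℝ) : ℂ := Complex.exp (2 * Complex.I * (ζ : ℂ) * (s : ℂ))

theorem continuous_osc (ζ : ℝ) : Continuous (osc ζ) := by unfold osc; fun_prop

theorem norm_osc (ζ s : ℝ) : ‖osc ζ s‖ = 1 := by
  rw [osc, show 2 * Complex.I * (ζ : ℂ) * (s : ℂ) = ((2 * ζ * s : ℝ) : ℂ) * Complex.I by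
    push_cast; ring, Complex.norm_exp_ofReal_mul_I]

theorem osc_neg_mul_osc (ζ s : ℝ) : osc (-ζ) s * osc ζ s = 1 := by
  rw [osc, osc, ← Complex.exp_add]
  simp

theorem star_osc (ζ s : ℝ) : star (osc ζ s) = osc (-ζ) s := by
  simp [osc, ← Complex.exp_conj, Complex.conj_ofNat]

theorem hasDerivAt_osc (ζ s : ℝ) :
    HasDerivAt (osc ζ) (2 * Complex.I * (ζ : ℂ) * osc ζ s) s := by
  have h := ((Complex.ofRealCLM.hasDerivAt (x := s)).const_mul (2 * Complex.I * (ζ : ℂ))).cexp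
  simp only [Complex.ofRealCLM_apply, Complex.ofReal_one, mul_one] at h
  rw [mul_comm]
  exact h

/-- The primitive of `e^{2iζs} φ(s)` vanishing at `-1/2`. -/
noncomputable def oscPrimitive (φ : ℝ → ℝ) (ζ u : ℝ) : ℂ :=
  ∫ s in (-1 / 2 : ℝ)..u, osc ζ s * (φ s : ℂ)

theorem norm_integral_le_of_bound {f : ℝ → ℂ} {K u : ℝ} (hK : 0 ≤ K)
    (hu : u ∈ Set.Icc (-1 / 2 : ℝ) (1 / 2)) (hf : ∀ s ∈ Set.Icc (-1 / 2 : ℝ) (1 / 2), ‖f s‖ ≤ K) :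
    ‖∫ s in (-1 / 2 : ℝ)..u, f s‖ ≤ K := by
  have h := intervalIntegral.norm_integral_le_of_norm_le_const (a := -1 / 2) (b := u) (C := K)
    (f := f) (fun s hs => by
      rw [Set.uIoc_of_le hu.1] at hs
      exact hf s ⟨hs.1.le, hs.2.trans hu.2⟩)
  refine h.trans ?_
  have : |u - -1 / 2| ≤ 1 := by rw [abs_le]; constructor <;> linarith [hu.1, hu.2]
  nlinarith

theorem norm_oscPrimitive_le {φ : ℝ → ℝ} {D u : ℝ} (hD : ∀ s, |φ s| ≤ D)
    (hu : u ∈ Set.Icc (-1 / 2 : ℝ) (1 / 2)) (ζ : ℝ) : ‖oscPrimitive φ ζ u‖ ≤ D := by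
  refine norm_integral_le_of_bound ((abs_nonneg _).trans (hD 0)) hu fun s _ => ?_
  simpa [norm_osc] using hD s

theorem hasDerivAt_oscPrimitive {φ : ℝ → ℝ} (hφ : Continuous φ) (ζ u : ℝ) :
    HasDerivAt (oscPrimitive φ ζ) (osc ζ u * (φ u : ℂ)) u := by
  have hc : Continuous fun s => osc ζ s * (φ s : ℂ) :=
    (continuous_osc ζ).mul (Complex.continuous_ofReal.comp hφ)
  exact intervalIntegral.integral_hasDerivAt_right (hc.intervalIntegrable _ _)
    (hc.stronglyMeasurableAtFilter _ _) hc.continuousAt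

theorem continuous_oscPrimitive {φ : ℝ → ℝ} (hφ : Continuous φ) (ζ : ℝ) :
    Continuous (oscPrimitive φ ζ) :=
  continuous_iff_continuousAt.2 fun u => (hasDerivAt_oscPrimitive hφ ζ u).continuousAt

/-- One integration by parts. The boundary term at `u` is kept explicit: multiplied by the conjugate
oscillation it stops oscillating and produces the main term of second order. -/
theorem oscPrimitive_eq {φ : ℝ → ℝ} (hφ : ContDiff ℝ 1 φ) (h0 : φ (-1 / 2) = 0) {ζ : ℝ}
    (hζ : ζ ≠ 0) (u : ℝ) :
    oscPrimitive φ ζ u = osc ζ u * (φ u : ℂ) / (2 * Complex.I * ζ) -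
      (1 / (2 * Complex.I * ζ)) * oscPrimitive (deriv φ) ζ u := by
  have hne : 2 * Complex.I * (ζ : ℂ) ≠ 0 := by simp [hζ]
  have hd : ∀ s, HasDerivAt (fun s => (φ s : ℂ)) ((deriv φ s : ℝ) : ℂ) s := fun s =>
    ((hφ.differentiable (by norm_num) s).hasDerivAt).ofReal_comp
  have hcd : Continuous (deriv φ) := hφ.continuous_deriv (by norm_num)
  have h := intervalIntegral.integral_mul_deriv_eq_deriv_mul (a := -1 / 2) (b := u)
    (u := fun s => (φ s : ℂ)) (v := osc ζ) (fun s _ => hd s) (fun s _ => hasDerivAt_osc ζ s)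
    ((Complex.continuous_ofReal.comp hcd).intervalIntegrable _ _)
    ((continuous_const.mul (continuous_osc ζ)).intervalIntegrable _ _)
  have h1 : ∫ s in (-1 / 2 : ℝ)..u, (φ s : ℂ) * (2 * Complex.I * (ζ : ℂ) * osc ζ s) =
      2 * Complex.I * (ζ : ℂ) * oscPrimitive φ ζ u := by
    rw [oscPrimitive, ← intervalIntegral.integral_const_mul]
    exact intervalIntegral.integral_congr fun s _ => by ring
  have h2 : ∫ s in (-1 / 2 : ℝ)..u, ((deriv φ s : ℝ) : ℂ) * osc ζ s = oscPrimitive (deriv φ) ζ u :=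
    intervalIntegral.integral_congr fun s _ => by ring
  rw [h1, h2, h0] at h
  simp only [Complex.ofReal_zero, zero_mul, sub_zero] at h
  have h3 : oscPrimitive φ ζ u =
      (osc ζ u * (φ u : ℂ) - oscPrimitive (deriv φ) ζ u) / (2 * Complex.I * ζ) := by
    rw [eq_div_iff hne]
    linear_combination h
  rw [h3]
  ring

/-- A smooth profile on `[-1/2, 1/2]`, vanishing near the end points, with two derivatives
bounded by `D`. -/
structure IsProfile (φ : ℝ → ℝ) (D : ℝ) : Prop where
  contDiff : ContDiff ℝ 2 φ
  one_le : 1 ≤ D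
  left : φ (-1 / 2) = 0
  right : φ (1 / 2) = 0
  deriv_left : deriv φ (-1 / 2) = 0
  bound : ∀ s, |φ s| ≤ D
  bound_deriv : ∀ s, |deriv φ s| ≤ D
  bound_deriv_deriv : ∀ s, |deriv (deriv φ) s| ≤ D

theorem norm_oscPrimitive_le_div {φ : ℝ → ℝ} {D ζ u : ℝ} (hφ : ContDiff ℝ 1 φ)
    (h0 : φ (-1 / 2) = 0) (hD : ∀ s, |φ s| ≤ D) (hD' : ∀ s, |deriv φ s| ≤ D) (hζ : ζ ≠ 0)
    (hu : u ∈ Set.Icc (-1 / 2 : ℝ) (1 / 2)) : ‖oscPrimitive φ ζ u‖ ≤ D / |ζ| := by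
  rw [oscPrimitive_eq hφ h0 hζ]
  have h1 : ‖osc ζ u * (φ u : ℂ) / (2 * Complex.I * ζ)‖ ≤ D / (2 * |ζ|) := by
    rw [norm_div, norm_mul, norm_osc]
    simp only [norm_mul, Complex.norm_I, Complex.norm_real, Real.norm_eq_abs, Complex.norm_ofNat,
      one_mul, mul_one]
    gcongr
    exact hD u
  have h2 : ‖(1 / (2 * Complex.I * ζ)) * oscPrimitive (deriv φ) ζ u‖ ≤ D / (2 * |ζ|) := by
    rw [norm_mul, norm_div]
    simp only [norm_mul, Complex.norm_I, Complex.norm_real, Real.norm_eq_abs, Complex.norm_ofNat,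
      norm_one, mul_one]
    rw [div_mul_eq_mul_div, one_mul]
    gcongr
    exact norm_oscPrimitive_le hD' hu ζ
  refine (norm_sub_le _ _).trans ((add_le_add h1 h2).trans (le_of_eq ?_))
  have : |ζ| ≠ 0 := abs_ne_zero.2 hζ
  field_simp
  norm_num

namespace IsProfile

variable {φ : ℝ → ℝ} {D : ℝ}

theorem contDiff_one (h : IsProfile φ D) : ContDiff ℝ 1 φ := h.contDiff.of_le (by norm_num)

theorem contDiff_deriv (h : IsProfile φ D) : ContDiff ℝ 1 (deriv φ) :=
  ((contDiff_succ_iff_deriv (n := 1)).1 (by rw [one_add_one_eq_two]; exact h.contDiff)).2.2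

theorem continuous (h : IsProfile φ D) : Continuous φ := h.contDiff.continuous

theorem norm_primitive_le (h : IsProfile φ D) {ζ u : ℝ} (hζ : ζ ≠ 0)
    (hu : u ∈ Set.Icc (-1 / 2 : ℝ) (1 / 2)) : ‖oscPrimitive φ ζ u‖ ≤ D / |ζ| :=
  norm_oscPrimitive_le_div h.contDiff_one h.left h.bound h.bound_deriv hζ hu

/-- A second integration by parts, applied to `deriv φ`, bounds what is left after the boundary
term. This is where the vanishing of `deriv φ` at the left end and the bound on the second
derivative enter. -/
theorem norm_primitive_sub_le (h : IsProfile φ D) {ζ u : ℝ} (hζ : ζ ≠ 0)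
    (hu : u ∈ Set.Icc (-1 / 2 : ℝ) (1 / 2)) :
    ‖oscPrimitive φ ζ u - osc ζ u * (φ u : ℂ) / (2 * Complex.I * ζ)‖ ≤ D / ζ ^ 2 := by
  rw [oscPrimitive_eq h.contDiff_one h.left hζ, sub_sub_cancel_left, norm_neg, norm_mul, norm_div]
  simp only [norm_mul, Complex.norm_I, Complex.norm_real, Real.norm_eq_abs, Complex.norm_ofNat,
      norm_one, mul_one]
  have h1 := norm_oscPrimitive_le_div h.contDiff_deriv h.deriv_left h.bound_deriv
    h.bound_deriv_deriv hζ hu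
  have hp : 0 < |ζ| := abs_pos.2 hζ
  have hD : 0 ≤ D := zero_le_one.trans h.one_le
  calc 1 / (2 * |ζ|) * ‖oscPrimitive (deriv φ) ζ u‖ ≤ 1 / (2 * |ζ|) * (D / |ζ|) := by gcongr
    _ = (D / ζ ^ 2) / 2 := by rw [← sq_abs ζ]; field_simp
    _ ≤ D / ζ ^ 2 := half_le_self (by positivity)

/-- Over a full block the boundary term vanishes. The resulting quadratic decay makes the first
order block integrals summable. -/
theorem norm_primitive_right_le (h : IsProfile φ D) {ζ : ℝ} (hζ : ζ ≠ 0) :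
    ‖oscPrimitive φ ζ (1 / 2)‖ ≤ D / ζ ^ 2 := by
  have h1 := h.norm_primitive_sub_le hζ (u := 1 / 2) (by norm_num)
  rwa [h.right, Complex.ofReal_zero, mul_zero, zero_div, sub_zero] at h1

end IsProfile

/-! ### First, second and third order integrals of a two-frequency block -/

/-- A block with two frequencies: `u ↦ (α e^{2iξu} + β e^{2iηu}) φ(u)`. -/
noncomputable def block (φ : ℝ → ℝ) (α β : ℂ) (ξ η u : ℝ) : ℂ :=
  (α * osc ξ u + β * osc η u) * (φ u : ℂ)

section Block

variable {φ : ℝ → ℝ} {D ξ η u : ℝ} {α β : ℂ}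

theorem continuous_block (hφ : Continuous φ) (α β : ℂ) (ξ η : ℝ) :
    Continuous (block φ α β ξ η) := by
  have := continuous_osc ξ
  have := continuous_osc η
  unfold block; fun_prop

theorem integral_block (hφ : Continuous φ) (α β : ℂ) (ξ η u : ℝ) :
    ∫ s in (-1 / 2 : ℝ)..u, block φ α β ξ η s =
      α * oscPrimitive φ ξ u + β * oscPrimitive φ η u := by
  have h : ∀ ζ, Continuous fun s => osc ζ s * (φ s : ℂ) := fun ζ =>
    (continuous_osc ζ).mul (Complex.continuous_ofReal.comp hφ)
  unfold oscPrimitive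
  rw [← intervalIntegral.integral_const_mul, ← intervalIntegral.integral_const_mul]
  have h1 : Continuous fun s => α * (osc ξ s * (φ s : ℂ)) := continuous_const.mul (h ξ)
  have h2 : Continuous fun s => β * (osc η s * (φ s : ℂ)) := continuous_const.mul (h η)
  rw [← intervalIntegral.integral_add (h1.intervalIntegrable _ _) (h2.intervalIntegrable _ _)]
  refine intervalIntegral.integral_congr fun s _ => ?_
  simp only [block]
  ring

theorem norm_block_le (hD : ∀ s, |φ s| ≤ D) (hα : ‖α‖ = 1 / 2) (hβ : ‖β‖ = 1 / 2) (ξ η s : ℝ) :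
    ‖block φ α β ξ η s‖ ≤ D := by
  have h1 : ‖α * osc ξ s + β * osc η s‖ ≤ 1 := by
    refine (norm_add_le _ _).trans ?_
    rw [norm_mul, norm_mul, norm_osc, norm_osc, hα, hβ]
    norm_num
  rw [block, norm_mul, Complex.norm_real, Real.norm_eq_abs]
  calc _ ≤ 1 * D := mul_le_mul h1 (hD s) (abs_nonneg _) zero_le_one
    _ = D := one_mul D

/-- Integration by parts for a pair of primitives of different frequencies. -/
theorem norm_integral_osc_mul_primitive_le (h : IsProfile φ D) {ζ : ℝ} (hζ : ζ ≠ 0) (ξ : ℝ)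
    (hu : u ∈ Set.Icc (-1 / 2 : ℝ) (1 / 2)) :
    ‖∫ s in (-1 / 2 : ℝ)..u, osc ζ s * (φ s : ℂ) * oscPrimitive φ ξ s‖ ≤ 2 * (D ^ 2 / |ζ|) := by
  have hc : ∀ ζ, Continuous fun s => osc ζ s * (φ s : ℂ) := fun ζ =>
    (continuous_osc ζ).mul (Complex.continuous_ofReal.comp h.continuous)
  have hD : 0 ≤ D := zero_le_one.trans h.one_le
  have hI := intervalIntegral.integral_mul_deriv_eq_deriv_mul (a := -1 / 2) (b := u)
    (fun s _ => hasDerivAt_oscPrimitive h.continuous ξ s)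
    (fun s _ => hasDerivAt_oscPrimitive h.continuous ζ s)
    ((hc ξ).intervalIntegrable _ _) ((hc ζ).intervalIntegrable _ _)
  have h0 : oscPrimitive φ ξ (-1 / 2) = 0 := by simp [oscPrimitive]
  rw [h0, zero_mul, sub_zero] at hI
  rw [show (∫ s in (-1 / 2 : ℝ)..u, osc ζ s * (φ s : ℂ) * oscPrimitive φ ξ s) =
    ∫ s in (-1 / 2 : ℝ)..u, oscPrimitive φ ξ s * (osc ζ s * (φ s : ℂ)) from
    intervalIntegral.integral_congr fun s _ => by ring, hI]
  refine (norm_sub_le _ _).trans ?_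
  have h1 : ‖oscPrimitive φ ξ u * oscPrimitive φ ζ u‖ ≤ D ^ 2 / |ζ| := by
    rw [norm_mul, pow_two, mul_div_assoc]
    exact mul_le_mul (norm_oscPrimitive_le h.bound hu _) (h.norm_primitive_le hζ hu)
      (norm_nonneg _) hD
  have h2 : ‖∫ s in (-1 / 2 : ℝ)..u, osc ξ s * (φ s : ℂ) * oscPrimitive φ ζ s‖ ≤ D ^ 2 / |ζ| := by
    refine norm_integral_le_of_bound (by positivity) hu fun s hs => ?_
    rw [norm_mul, norm_mul, norm_osc, one_mul, Complex.norm_real, Real.norm_eq_abs, pow_two,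
      mul_div_assoc]
    exact mul_le_mul (h.bound s) (h.norm_primitive_le hζ hs) (norm_nonneg _) hD
  linarith

/-- The running `L²` mass of the profile. -/
noncomputable def mass (φ : ℝ → ℝ) (u : ℝ) : ℂ := ∫ s in (-1 / 2 : ℝ)..u, ((φ s ^ 2 : ℝ) : ℂ)

theorem star_block (φ : ℝ → ℝ) (α β : ℂ) (ξ η s : ℝ) :
    star (block φ α β ξ η s) = (star α * osc (-ξ) s + star β * osc (-η) s) * (φ s : ℂ) := by
  rw [block, star_mul', star_add, star_mul', star_mul', star_osc, star_osc]
  simp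

/-- Only the pairing of frequency `ξ` with its own conjugate has a non-oscillating part: there the
boundary term of the primitive contributes `|α|² φ² / (2iξ) = φ² / (8iξ)`. Every pairing involving
`η` gains a factor `1/|η|`. -/
theorem norm_iterTwo_block_sub_le (h : IsProfile φ D) (hα : ‖α‖ = 1 / 2) (hβ : ‖β‖ = 1 / 2)
    (hξ : ξ ≠ 0) (hη : η ≠ 0) (hu : u ∈ Set.Icc (-1 / 2 : ℝ) (1 / 2)) :
    ‖iterTwo (block φ α β ξ η) (fun s => star (block φ α β ξ η s)) (-1 / 2) u -
        1 / (8 * Complex.I * ξ) * mass φ u‖ ≤ 2 * D ^ 2 * (1 / ξ ^ 2 + 1 / |η|) := by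
  have hD : 0 ≤ D := zero_le_one.trans h.one_le
  have hφc : Continuous fun s => (φ s : ℂ) := Complex.continuous_ofReal.comp h.continuous
  have hoc := continuous_osc
  have hEc := fun ζ => continuous_oscPrimitive h.continuous ζ
  have hbc : Continuous fun s => star (block φ α β ξ η s) :=
    continuous_star.comp (continuous_block h.continuous α β ξ η)
  have hαα : star α * α = 1 / 4 := by
    rw [mul_comm]
    change α * (starRingEnd ℂ) α = _
    rw [Complex.mul_conj, Complex.normSq_eq_norm_sq, hα]; norm_num
  set R : ℝ → ℂ := fun s => oscPrimitive φ ξ s - osc ξ s * (φ s : ℂ) / (2 * Complex.I * ξ) with hR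
  have hRc : Continuous R := by
    have := hEc ξ; have := hoc ξ
    simp only [hR]; fun_prop
  set f₁ : ℝ → ℂ := fun s => star (block φ α β ξ η s) * (β * oscPrimitive φ η s) with hf₁
  set f₂ : ℝ → ℂ := fun s => osc (-η) s * (φ s : ℂ) * oscPrimitive φ ξ s with hf₂
  set f₃ : ℝ → ℂ := fun s => (1 / 4) * (osc (-ξ) s * (φ s : ℂ) * R s) with hf₃
  have hc₁ : Continuous f₁ := hbc.mul (continuous_const.mul (hEc η))
  have hc₂ : Continuous f₂ := ((hoc _).mul hφc).mul (hEc _)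
  have hc₃ : Continuous f₃ := continuous_const.mul (((hoc _).mul hφc).mul hRc)
  have hm : Continuous fun s => ((φ s ^ 2 : ℝ) : ℂ) :=
    Complex.continuous_ofReal.comp (h.continuous.pow 2)
  -- `f₁` collects the pairings whose inner frequency is `η`. `f₂` has inner frequency `ξ` and outer
  -- frequency `-η`. `f₃` is the pairing of `ξ` with `-ξ` after removal of its boundary term.
  have hdecomp : iterTwo (block φ α β ξ η) (fun s => star (block φ α β ξ η s)) (-1 / 2) u -
      1 / (8 * Complex.I * ξ) * mass φ u =
      (∫ s in (-1 / 2 : ℝ)..u, f₁ s) + star β * α * (∫ s in (-1 / 2 : ℝ)..u, f₂ s) +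
        ∫ s in (-1 / 2 : ℝ)..u, f₃ s := by
    have hc₂' : Continuous fun s => star β * α * f₂ s := continuous_const.mul hc₂
    have hm' : Continuous fun s => 1 / (8 * Complex.I * ξ) * ((φ s ^ 2 : ℝ) : ℂ) :=
      continuous_const.mul hm
    have hc₁₂ : Continuous fun s => f₁ s + star β * α * f₂ s := hc₁.add hc₂'
    have hc₁₂₃ : Continuous fun s => f₁ s + star β * α * f₂ s + f₃ s := hc₁₂.add hc₃
    rw [sub_eq_iff_eq_add, mass, ← intervalIntegral.integral_const_mul,
      ← intervalIntegral.integral_const_mul,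
      ← intervalIntegral.integral_add (hc₁.intervalIntegrable _ _) (hc₂'.intervalIntegrable _ _),
      ← intervalIntegral.integral_add (hc₁₂.intervalIntegrable _ _) (hc₃.intervalIntegrable _ _),
      ← intervalIntegral.integral_add (hc₁₂₃.intervalIntegrable _ _) (hm'.intervalIntegrable _ _)]
    refine intervalIntegral.integral_congr fun s _ => ?_
    simp only [integral_block h.continuous, hf₁, hf₂, hf₃, hR, star_block]
    have h1 := osc_neg_mul_osc ξ s
    have hne : (ξ : ℂ) ≠ 0 := by exact_mod_cast hξ
    have hE : oscPrimitive φ ξ s = R s + osc ξ s * (φ s : ℂ) / (2 * Complex.I * ξ) := by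
      simp [hR]
    push_cast
    have h2 : osc (-ξ) s * (φ s : ℂ) * (osc ξ s * (φ s : ℂ) / (2 * Complex.I * ξ)) =
        4 * (1 / (8 * Complex.I * ξ) * (φ s : ℂ) ^ 2) := by
      rw [show osc (-ξ) s * (φ s : ℂ) * (osc ξ s * (φ s : ℂ) / (2 * Complex.I * ξ)) =
        (osc (-ξ) s * osc ξ s) * ((φ s : ℂ) * (φ s : ℂ) / (2 * Complex.I * ξ)) by ring, h1]
      field_simp
      ring
    linear_combination (osc (-ξ) s * (φ s : ℂ) * oscPrimitive φ ξ s) * hαα + (1 / 4) * h2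
  rw [hdecomp]
  have hηp : 0 < |η| := abs_pos.2 hη
  have b₁ : ‖∫ s in (-1 / 2 : ℝ)..u, f₁ s‖ ≤ D ^ 2 / |η| := by
    refine norm_integral_le_of_bound (by positivity) hu fun s hs => ?_
    rw [hf₁]
    simp only [norm_mul, norm_star, hβ]
    have e1 := norm_block_le h.bound hα hβ ξ η s
    have e2 := h.norm_primitive_le hη hs
    calc _ ≤ D * (1 / 2 * (D / |η|)) := by gcongr
      _ = (D ^ 2 / |η|) / 2 := by ring
      _ ≤ _ := half_le_self (by positivity)
  have b₂ : ‖star β * α * (∫ s in (-1 / 2 : ℝ)..u, f₂ s)‖ ≤ D ^ 2 / |η| := by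
    rw [norm_mul, norm_mul, norm_star, hα, hβ]
    have e := norm_integral_osc_mul_primitive_le h (neg_ne_zero.2 hη) ξ hu
    rw [abs_neg] at e
    calc _ ≤ 1 / 2 * (1 / 2) * (2 * (D ^ 2 / |η|)) := by gcongr
      _ = (D ^ 2 / |η|) / 2 := by ring
      _ ≤ _ := half_le_self (by positivity)
  have b₃ : ‖∫ s in (-1 / 2 : ℝ)..u, f₃ s‖ ≤ D ^ 2 / ξ ^ 2 := by
    refine norm_integral_le_of_bound (by positivity) hu fun s hs => ?_
    have e2 := h.norm_primitive_sub_le hξ hs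
    have e1 : ‖(φ s : ℂ)‖ ≤ D := by simpa using h.bound s
    rw [hf₃]
    simp only [norm_mul, norm_osc, one_mul]
    calc _ ≤ ‖(1 / 4 : ℂ)‖ * (D * (D / ξ ^ 2)) := by gcongr
      _ = 1 / 4 * (D ^ 2 / ξ ^ 2) := by norm_num; ring
      _ ≤ _ := by linarith [show 0 ≤ D ^ 2 / ξ ^ 2 by positivity]
  have e3 := norm_add₃_le (a := ∫ s in (-1 / 2 : ℝ)..u, f₁ s)
    (b := star β * α * (∫ s in (-1 / 2 : ℝ)..u, f₂ s)) (c := ∫ s in (-1 / 2 : ℝ)..u, f₃ s)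
  have e4 : 0 ≤ D ^ 2 / ξ ^ 2 := by positivity
  calc _ ≤ D ^ 2 / |η| + D ^ 2 / |η| + D ^ 2 / ξ ^ 2 := by linarith
    _ ≤ 2 * (D ^ 2 / |η|) + 2 * (D ^ 2 / ξ ^ 2) := by linarith
    _ = _ := by ring

theorem norm_integral_block_le (h : IsProfile φ D) (hα : ‖α‖ = 1 / 2) (hβ : ‖β‖ = 1 / 2)
    (ξ η : ℝ) (hu : u ∈ Set.Icc (-1 / 2 : ℝ) (1 / 2)) :
    ‖∫ s in (-1 / 2 : ℝ)..u, block φ α β ξ η s‖ ≤ D :=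
  norm_integral_le_of_bound (zero_le_one.trans h.one_le) hu fun s _ =>
    norm_block_le h.bound hα hβ ξ η s

theorem norm_iterTwo_block_le (h : IsProfile φ D) (hα : ‖α‖ = 1 / 2) (hβ : ‖β‖ = 1 / 2)
    (ξ η : ℝ) (hu : u ∈ Set.Icc (-1 / 2 : ℝ) (1 / 2)) :
    ‖iterTwo (block φ α β ξ η) (fun s => star (block φ α β ξ η s)) (-1 / 2) u‖ ≤ D ^ 2 := by
  have hD : 0 ≤ D := zero_le_one.trans h.one_le
  refine norm_integral_le_of_bound (by positivity) hu fun s hs => ?_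
  rw [norm_mul, norm_star, pow_two]
  exact mul_le_mul (norm_block_le h.bound hα hβ ξ η s) (norm_integral_block_le h hα hβ ξ η hs)
    (norm_nonneg _) hD

theorem norm_iterThree_block_le (h : IsProfile φ D) (hα : ‖α‖ = 1 / 2) (hβ : ‖β‖ = 1 / 2)
    (ξ η : ℝ) :
    ‖iterThree (block φ α β ξ η) (fun s => star (block φ α β ξ η s)) (block φ α β ξ η)
      (-1 / 2) (1 / 2)‖ ≤ D ^ 3 := by
  have hD : 0 ≤ D := zero_le_one.trans h.one_le
  refine norm_integral_le_of_bound (by positivity) (by norm_num) fun s hs => ?_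
  rw [norm_mul, show D ^ 3 = D * D ^ 2 by ring]
  exact mul_le_mul (norm_block_le h.bound hα hβ ξ η s) (norm_iterTwo_block_le h hα hβ ξ η hs)
    (norm_nonneg _) hD

theorem norm_integral_block_right_le (h : IsProfile φ D) (hα : ‖α‖ = 1 / 2) (hβ : ‖β‖ = 1 / 2)
    (hξ : ξ ≠ 0) (hη : η ≠ 0) :
    ‖∫ s in (-1 / 2 : ℝ)..(1 / 2), block φ α β ξ η s‖ ≤ D * (1 / ξ ^ 2 + 1 / η ^ 2) := by
  rw [integral_block h.continuous]
  refine (norm_add_le _ _).trans ?_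
  rw [norm_mul, norm_mul, hα, hβ]
  have h1 := h.norm_primitive_right_le hξ
  have h2 := h.norm_primitive_right_le hη
  have hD : 0 ≤ D := zero_le_one.trans h.one_le
  have e1 : 0 ≤ D / ξ ^ 2 := by positivity
  have e2 : 0 ≤ D / η ^ 2 := by positivity
  rw [mul_add, mul_one_div, mul_one_div]
  linarith

/-- The inner second order integral is `mass φ / (8iξ)` up to a summable error. The remaining outer
oscillation against the slowly varying mass gains a further `1/|ξ| + 1/|η|`, so no term of order
`1/|ξ|` survives. -/
theorem norm_iterThree_block_le_div (h : IsProfile φ D) (hα : ‖α‖ = 1 / 2) (hβ : ‖β‖ = 1 / 2)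
    (hξ : 1 ≤ |ξ|) (hη : η ≠ 0) :
    ‖iterThree (block φ α β ξ η) (fun s => star (block φ α β ξ η s)) (block φ α β ξ η)
      (-1 / 2) (1 / 2)‖ ≤ 3 * D ^ 3 * (1 / ξ ^ 2 + 1 / |η|) := by
  have hD : 0 ≤ D := zero_le_one.trans h.one_le
  have hξ0 : ξ ≠ 0 := abs_pos.1 (zero_lt_one.trans_le hξ)
  have hξp : 0 < |ξ| := zero_lt_one.trans_le hξ
  have hηp : 0 < |η| := abs_pos.2 hη
  set g := block φ α β ξ η with hg
  have hgc : Continuous g := continuous_block h.continuous α β ξ η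
  set G : ℝ → ℂ := fun u => ∫ s in (-1 / 2 : ℝ)..u, g s with hG
  have hm : Continuous fun s => ((φ s ^ 2 : ℝ) : ℂ) :=
    Complex.continuous_ofReal.comp (h.continuous.pow 2)
  have hmc : Continuous (mass φ) := continuous_primitive hm _
  have hGd : ∀ u, HasDerivAt G (g u) u := fun u =>
    intervalIntegral.integral_hasDerivAt_right (hgc.intervalIntegrable _ _)
      (hgc.stronglyMeasurableAtFilter _ _) hgc.continuousAt
  have hmd : ∀ u, HasDerivAt (mass φ) ((φ u ^ 2 : ℝ) : ℂ) u := fun u =>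
    intervalIntegral.integral_hasDerivAt_right (hm.intervalIntegrable _ _)
      (hm.stronglyMeasurableAtFilter _ _) hm.continuousAt
  have hsq : ∀ s, ‖((φ s ^ 2 : ℝ) : ℂ)‖ ≤ D ^ 2 := fun s => by
    rw [Complex.norm_real, Real.norm_eq_abs, abs_pow]
    exact pow_le_pow_left₀ (abs_nonneg _) (h.bound s) 2
  have hGb : ∀ u ∈ Set.Icc (-1 / 2 : ℝ) (1 / 2), ‖G u‖ ≤ D * (1 / |ξ| + 1 / |η|) := fun u hu => by
    rw [hG, hg]
    simp only [integral_block h.continuous]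
    refine (norm_add_le _ _).trans ?_
    rw [norm_mul, norm_mul, hα, hβ]
    have h1 := h.norm_primitive_le hξ0 hu
    have h2 := h.norm_primitive_le hη hu
    have e1 : 0 ≤ D / |ξ| := by positivity
    have e2 : 0 ≤ D / |η| := by positivity
    rw [mul_add, mul_one_div, mul_one_div]
    linarith
  -- Integration by parts puts the derivative on `mass φ`, where it gives `φ²`, and leaves the small
  -- primitive `G`.
  have hmain : ‖∫ u in (-1 / 2 : ℝ)..(1 / 2), g u * mass φ u‖ ≤
      2 * (D ^ 3 * (1 / |ξ| + 1 / |η|)) := by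
    have hI := intervalIntegral.integral_mul_deriv_eq_deriv_mul (a := -1 / 2) (b := 1 / 2)
      (fun s _ => hmd s) (fun s _ => hGd s) (hm.intervalIntegrable _ _)
      (hgc.intervalIntegrable _ _)
    have h0 : mass φ (-1 / 2) = 0 := by simp [mass]
    rw [h0, zero_mul, sub_zero] at hI
    rw [show (∫ u in (-1 / 2 : ℝ)..(1 / 2), g u * mass φ u) =
      ∫ u in (-1 / 2 : ℝ)..(1 / 2), mass φ u * g u from
      intervalIntegral.integral_congr fun s _ => mul_comm _ _, hI]
    refine (norm_sub_le _ _).trans ?_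
    have e1 : ‖mass φ (1 / 2) * G (1 / 2)‖ ≤ D ^ 3 * (1 / |ξ| + 1 / |η|) := by
      rw [norm_mul, show D ^ 3 * (1 / |ξ| + 1 / |η|) = D ^ 2 * (D * (1 / |ξ| + 1 / |η|)) by ring]
      exact mul_le_mul (norm_integral_le_of_bound (by positivity) (by norm_num) fun s _ => hsq s)
        (hGb _ (by norm_num)) (norm_nonneg _) (by positivity)
    have e2 : ‖∫ u in (-1 / 2 : ℝ)..(1 / 2), ((φ u ^ 2 : ℝ) : ℂ) * G u‖ ≤
        D ^ 3 * (1 / |ξ| + 1 / |η|) := by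
      refine norm_integral_le_of_bound (by positivity) (by norm_num) fun s hs => ?_
      rw [norm_mul, show D ^ 3 * (1 / |ξ| + 1 / |η|) = D ^ 2 * (D * (1 / |ξ| + 1 / |η|)) by ring]
      exact mul_le_mul (hsq s) (hGb _ hs) (norm_nonneg _) (by positivity)
    linarith
  set H := iterTwo g (fun s => star (g s)) (-1 / 2) with hH
  have hHc : Continuous H := continuous_iterTwo hgc (continuous_star.comp hgc) _
  set f : ℝ → ℂ := fun u => g u * (H u - 1 / (8 * Complex.I * ξ) * mass φ u) with hf
  have hfc : Continuous f := hgc.mul (hHc.sub (continuous_const.mul hmc))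
  have hsplit : iterThree g (fun s => star (g s)) g (-1 / 2) (1 / 2) =
      (∫ u in (-1 / 2 : ℝ)..(1 / 2), f u) +
        1 / (8 * Complex.I * ξ) * ∫ u in (-1 / 2 : ℝ)..(1 / 2), g u * mass φ u := by
    have hc' : Continuous fun u => 1 / (8 * Complex.I * ξ) * (g u * mass φ u) :=
      continuous_const.mul (hgc.mul hmc)
    rw [← intervalIntegral.integral_const_mul,
      ← intervalIntegral.integral_add (hfc.intervalIntegrable _ _) (hc'.intervalIntegrable _ _)]
    refine intervalIntegral.integral_congr fun s _ => ?_
    simp only [hf, hH]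
    ring
  have b₁ : ‖∫ u in (-1 / 2 : ℝ)..(1 / 2), f u‖ ≤ 2 * D ^ 3 * (1 / ξ ^ 2 + 1 / |η|) := by
    refine norm_integral_le_of_bound (by positivity) (by norm_num) fun s hs => ?_
    rw [hf]
    simp only [norm_mul]
    rw [show 2 * D ^ 3 * (1 / ξ ^ 2 + 1 / |η|) = D * (2 * D ^ 2 * (1 / ξ ^ 2 + 1 / |η|)) by ring]
    exact mul_le_mul (norm_block_le h.bound hα hβ ξ η s)
      (norm_iterTwo_block_sub_le h hα hβ hξ0 hη hs) (norm_nonneg _) hD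
  have b₂ : ‖1 / (8 * Complex.I * ξ) * ∫ u in (-1 / 2 : ℝ)..(1 / 2), g u * mass φ u‖ ≤
      D ^ 3 * (1 / ξ ^ 2 + 1 / |η|) := by
    rw [norm_mul, norm_div]
    simp only [norm_mul, Complex.norm_I, Complex.norm_real, Real.norm_eq_abs, Complex.norm_ofNat,
      norm_one, mul_one]
    calc _ ≤ 1 / (8 * |ξ|) * (2 * (D ^ 3 * (1 / |ξ| + 1 / |η|))) := by gcongr
      _ = (D ^ 3 * (1 / |ξ| ^ 2 + 1 / |η| * (1 / |ξ|))) * (1 / 4) := by field_simp; ring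
      _ ≤ (D ^ 3 * (1 / |ξ| ^ 2 + 1 / |η| * 1)) * 1 := by
        gcongr
        · rw [div_le_one hξp]; exact hξ
        · norm_num
      _ = _ := by rw [sq_abs]; ring
  rw [hsplit]
  refine (norm_add_le _ _).trans ?_
  linarith

end Block

/-! ### Combining blocks through Chen's recursion -/

/-- The iterated sums of a sequence of blocks with first, second and third order integrals
`p`, `t`, `s`, as dictated by Chen's identity. -/
structure IsIteratedSum (p t s P Q S : ℕ → ℂ) : Prop where
  P_zero : P 0 = 0
  Q_zero : Q 0 = 0
  S_zero : S 0 = 0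
  P_succ : ∀ i, P (i + 1) = P i + p i
  Q_succ : ∀ i, Q (i + 1) = Q i + P i * star (p i) + t i
  S_succ : ∀ i, S (i + 1) = S i + Q i * p i + P i * star (t i) + s i

namespace IsIteratedSum

variable {p t s P Q S : ℕ → ℂ}

theorem P_eq (h : IsIteratedSum p t s P Q S) (n : ℕ) : P n = ∑ i ∈ Finset.range n, p i := by
  induction n with
  | zero => simp [h.P_zero]
  | succ n ih => rw [h.P_succ, ih, Finset.sum_range_succ]

theorem Q_eq (h : IsIteratedSum p t s P Q S) (n : ℕ) :
    Q n = ∑ i ∈ Finset.range n, t i + ∑ i ∈ Finset.range n, P i * star (p i) := by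
  induction n with
  | zero => simp [h.Q_zero]
  | succ n ih => rw [h.Q_succ, ih, Finset.sum_range_succ, Finset.sum_range_succ]; ring

theorem S_eq (h : IsIteratedSum p t s P Q S) (n : ℕ) :
    S n = ∑ i ∈ Finset.range n, Q i * p i + ∑ i ∈ Finset.range n, P i * star (t i) +
      ∑ i ∈ Finset.range n, s i := by
  induction n with
  | zero => simp [h.S_zero]
  | succ n ih =>
    rw [h.S_succ, ih, Finset.sum_range_succ, Finset.sum_range_succ, Finset.sum_range_succ]; ring

theorem norm_P_le (h : IsIteratedSum p t s P Q S) {M n : ℕ} {B : ℝ}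
    (hB : ∑ i ∈ Finset.range M, ‖p i‖ ≤ B) (hn : n ≤ M) : ‖P n‖ ≤ B := by
  rw [h.P_eq]
  refine (norm_sum_le _ _).trans (le_trans ?_ hB)
  exact Finset.sum_le_sum_of_subset_of_nonneg (Finset.range_mono hn) fun _ _ _ => norm_nonneg _

/-- Two variables in different blocks contribute a product of first order integrals, and all such
products together are at most `B²`. Only the diagonal sum of the `t i` can therefore be large. -/
theorem norm_Q_sub_le (h : IsIteratedSum p t s P Q S) {M n : ℕ} {B : ℝ}
    (hB : ∑ i ∈ Finset.range M, ‖p i‖ ≤ B) (hn : n ≤ M) :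
    ‖Q n - ∑ i ∈ Finset.range n, t i‖ ≤ B ^ 2 := by
  have hB0 : 0 ≤ B := (Finset.sum_nonneg fun _ _ => norm_nonneg _).trans hB
  rw [h.Q_eq, add_sub_cancel_left]
  calc ‖∑ i ∈ Finset.range n, P i * star (p i)‖
      ≤ ∑ i ∈ Finset.range n, ‖P i * star (p i)‖ := norm_sum_le _ _
    _ ≤ ∑ i ∈ Finset.range n, B * ‖p i‖ := by
        refine Finset.sum_le_sum fun i hi => ?_
        rw [norm_mul, norm_star]
        have := h.norm_P_le hB ((Finset.mem_range.1 hi).le.trans hn)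
        gcongr
    _ ≤ ∑ i ∈ Finset.range M, B * ‖p i‖ :=
        Finset.sum_le_sum_of_subset_of_nonneg (Finset.range_mono hn) fun _ _ _ => by positivity
    _ = B * ∑ i ∈ Finset.range M, ‖p i‖ := by rw [Finset.mul_sum]
    _ ≤ B ^ 2 := by rw [pow_two]; gcongr

/-- If all first order integrals but the `m`-th are small, the third order sum is governed by the
second order terms on both sides of `m`. -/
theorem norm_S_sub_le (h : IsIteratedSum p t s P Q S) {M m : ℕ} {B ε L : ℝ} (hm : m < M)
    (hB : ∑ i ∈ Finset.range M, ‖p i‖ ≤ B)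
    (hε : ∑ i ∈ (Finset.range M).erase m, ‖p i‖ ≤ ε)
    (hL : ∑ i ∈ Finset.range M, ‖t i‖ ≤ L) :
    ‖S M - p m * (∑ i ∈ Finset.range m, t i + ∑ i ∈ Finset.Ioo m M, star (t i))‖ ≤
      B ^ 3 + 2 * ε * L + ∑ i ∈ Finset.range M, ‖s i‖ := by
  have hB0 : 0 ≤ B := (Finset.sum_nonneg fun _ _ => norm_nonneg _).trans hB
  have hε0 : 0 ≤ ε := (Finset.sum_nonneg fun _ _ => norm_nonneg _).trans hε
  have hL0 : 0 ≤ L := (Finset.sum_nonneg fun _ _ => norm_nonneg _).trans hL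
  have hmM : m ∈ Finset.range M := Finset.mem_range.2 hm
  set τ : ℕ → ℂ := fun n => ∑ i ∈ Finset.range n, t i with hτ
  have hτL : ∀ n ≤ M, ‖τ n‖ ≤ L := fun n hn =>
    (norm_sum_le _ _).trans ((Finset.sum_le_sum_of_subset_of_nonneg (Finset.range_mono hn)
      fun _ _ _ => norm_nonneg _).trans hL)
  -- `Q i` is replaced by its diagonal part `τ i`, and the index `m` is singled out.
  have e1 : ∑ i ∈ Finset.range M, Q i * p i = p m * τ m +
      ∑ i ∈ (Finset.range M).erase m, τ i * p i +
        ∑ i ∈ Finset.range M, (Q i - τ i) * p i := by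
    rw [mul_comm (p m), Finset.add_sum_erase (Finset.range M) (fun i => τ i * p i) hmM,
      ← Finset.sum_add_distrib]
    exact Finset.sum_congr rfl fun i _ => by ring
  have e2 : ∑ i ∈ Finset.range M, P i * star (t i) =
      p m * ∑ i ∈ Finset.Ioo m M, star (t i) +
        ∑ i ∈ Finset.range M, (P i - if m < i then p m else 0) * star (t i) := by
    have : p m * ∑ i ∈ Finset.Ioo m M, star (t i) =
        ∑ i ∈ Finset.range M, (if m < i then p m else 0) * star (t i) := by
      rw [Finset.mul_sum]
      have : Finset.Ioo m M = (Finset.range M).filter (m < ·) := by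
        ext i; simp [and_comm]
      rw [this, Finset.sum_filter]
      exact Finset.sum_congr rfl fun i _ => by split_ifs <;> simp
    rw [this, ← Finset.sum_add_distrib]
    exact Finset.sum_congr rfl fun i _ => by ring
  -- The partial sums `P i` jump by `p m` just after `m` and are otherwise small, so up to `ε` they
  -- form a step function. The second order terms beyond `m` thus acquire the factor `p m`.
  have hP : ∀ i ≤ M, ‖P i - if m < i then p m else 0‖ ≤ ε := fun i hi => by
    have : P i - (if m < i then p m else 0) = ∑ j ∈ (Finset.range i).erase m, p j := by
      rw [h.P_eq]
      split_ifs with hmi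
      · rw [← Finset.add_sum_erase (Finset.range i) p (Finset.mem_range.2 hmi)]
        ring
      · rw [Finset.erase_eq_of_notMem (by simpa using hmi), sub_zero]
    rw [this]
    exact (norm_sum_le _ _).trans ((Finset.sum_le_sum_of_subset_of_nonneg
      (Finset.erase_subset_erase _ (Finset.range_mono hi)) fun _ _ _ => norm_nonneg _).trans hε)
  have b1 : ‖∑ i ∈ (Finset.range M).erase m, τ i * p i‖ ≤ ε * L := by
    calc _ ≤ ∑ i ∈ (Finset.range M).erase m, ‖τ i * p i‖ := norm_sum_le _ _
      _ ≤ ∑ i ∈ (Finset.range M).erase m, L * ‖p i‖ := by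
        refine Finset.sum_le_sum fun i hi => ?_
        rw [norm_mul]
        have := hτL i (Finset.mem_range.1 (Finset.mem_of_mem_erase hi)).le
        gcongr
      _ = L * ∑ i ∈ (Finset.range M).erase m, ‖p i‖ := by rw [Finset.mul_sum]
      _ ≤ L * ε := by gcongr
      _ = ε * L := mul_comm _ _
  have b2 : ‖∑ i ∈ Finset.range M, (Q i - τ i) * p i‖ ≤ B ^ 3 := by
    calc _ ≤ ∑ i ∈ Finset.range M, ‖(Q i - τ i) * p i‖ := norm_sum_le _ _
      _ ≤ ∑ i ∈ Finset.range M, B ^ 2 * ‖p i‖ := by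
        refine Finset.sum_le_sum fun i hi => ?_
        rw [norm_mul]
        have := h.norm_Q_sub_le hB (Finset.mem_range.1 hi).le
        gcongr
      _ = B ^ 2 * ∑ i ∈ Finset.range M, ‖p i‖ := by rw [Finset.mul_sum]
      _ ≤ B ^ 2 * B := by gcongr
      _ = B ^ 3 := by ring
  have b3 : ‖∑ i ∈ Finset.range M, (P i - if m < i then p m else 0) * star (t i)‖ ≤ ε * L := by
    calc _ ≤ ∑ i ∈ Finset.range M, ‖(P i - if m < i then p m else 0) * star (t i)‖ :=
          norm_sum_le _ _
      _ ≤ ∑ i ∈ Finset.range M, ε * ‖t i‖ := by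
        refine Finset.sum_le_sum fun i hi => ?_
        rw [norm_mul, norm_star]
        have := hP i (Finset.mem_range.1 hi).le
        gcongr
      _ = ε * ∑ i ∈ Finset.range M, ‖t i‖ := by rw [Finset.mul_sum]
      _ ≤ ε * L := by gcongr
  have b4 : ‖∑ i ∈ Finset.range M, s i‖ ≤ ∑ i ∈ Finset.range M, ‖s i‖ := norm_sum_le _ _
  have key : S M - p m * (∑ i ∈ Finset.range m, t i + ∑ i ∈ Finset.Ioo m M, star (t i)) =
      ∑ i ∈ (Finset.range M).erase m, τ i * p i + ∑ i ∈ Finset.range M, (Q i - τ i) * p i +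
        ∑ i ∈ Finset.range M, (P i - if m < i then p m else 0) * star (t i) +
          ∑ i ∈ Finset.range M, s i := by
    rw [h.S_eq, e1, e2]
    ring
  rw [key]
  refine (norm_add_le _ _).trans ?_
  have := norm_add₃_le (a := ∑ i ∈ (Finset.range M).erase m, τ i * p i)
    (b := ∑ i ∈ Finset.range M, (Q i - τ i) * p i)
    (c := ∑ i ∈ Finset.range M, (P i - if m < i then p m else 0) * star (t i))
  linarith

/-- The logarithmic sum `∑_{i ≠ m} κ / |ξ_i|` bounds the second order sum below when the
`t_i` are close to `κ / (i ξ_i)`. -/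
theorem le_norm_Q {κ R B : ℝ} {ξ : ℕ → ℝ} {M m : ℕ} (h : IsIteratedSum p t s P Q S) (hm : m ≤ M)
    (hξ : ∀ i < m, 0 < ξ i) (hB : ∑ i ∈ Finset.range M, ‖p i‖ ≤ B)
    (hR : ∑ i ∈ Finset.range m, ‖t i - κ / (Complex.I * ξ i)‖ ≤ R) :
    ∑ i ∈ Finset.range m, κ / |ξ i| - R - B ^ 2 ≤ ‖Q m‖ := by
  have e : ∑ i ∈ Finset.range m, (κ / (Complex.I * ξ i) : ℂ) =
      -Complex.I * ((∑ i ∈ Finset.range m, κ / |ξ i| : ℝ) : ℂ) := by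
    push_cast
    rw [Finset.mul_sum]
    refine Finset.sum_congr rfl fun i hi => ?_
    rw [abs_of_pos (hξ i (Finset.mem_range.1 hi)), ← div_div, ← mul_div_assoc, Complex.div_I]
    ring
  have h1 : ‖∑ i ∈ Finset.range m, t i - ∑ i ∈ Finset.range m, (κ / (Complex.I * ξ i) : ℂ)‖ ≤ R := by
    rw [← Finset.sum_sub_distrib]
    exact (norm_sum_le _ _).trans hR
  have h2 := h.norm_Q_sub_le hB hm
  have h3 : ∑ i ∈ Finset.range m, κ / |ξ i| ≤
      ‖∑ i ∈ Finset.range m, (κ / (Complex.I * ξ i) : ℂ)‖ := by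
    rw [e, norm_mul, norm_neg, Complex.norm_I, one_mul, Complex.norm_real]
    exact le_abs_self _
  have h4 := norm_sub_norm_le (∑ i ∈ Finset.range m, (κ / (Complex.I * ξ i) : ℂ))
    (∑ i ∈ Finset.range m, t i)
  rw [norm_sub_rev] at h4
  have h5 := norm_sub_norm_le (∑ i ∈ Finset.range m, t i) (Q m)
  rw [norm_sub_rev] at h5
  linarith

/-- The third order sum is bounded below by the same logarithmic sum: the contributions of the
two sides of `m` have the same sign. -/
theorem le_norm_S {κ R B ε c V : ℝ} {ξ : ℕ → ℝ} {M m : ℕ} (h : IsIteratedSum p t s P Q S)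
    (hm : m < M) (hκ : 0 ≤ κ) (hξ : ∀ i < m, 0 < ξ i) (hξ' : ∀ i, m < i → ξ i < 0)
    (hB : ∑ i ∈ Finset.range M, ‖p i‖ ≤ B)
    (hε : ∑ i ∈ (Finset.range M).erase m, ‖p i‖ ≤ ε) (hc : c ≤ ‖p m‖) (hεc : ε ≤ c / 4)
    (hR : ∑ i ∈ (Finset.range M).erase m, ‖t i - κ / (Complex.I * ξ i)‖ ≤ R)
    (htm : ‖t m‖ ≤ R) (hV : ∑ i ∈ Finset.range M, ‖s i‖ ≤ V) :
    c / 2 * ∑ i ∈ Finset.range m, κ / |ξ i| - 2 * B * R - B ^ 3 - V ≤ ‖S M‖ := by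
  have hmM : m ∈ Finset.range M := Finset.mem_range.2 hm
  have hε0 : 0 ≤ ε := (Finset.sum_nonneg fun _ _ => norm_nonneg _).trans hε
  have hR0 : 0 ≤ R := (norm_nonneg _).trans htm
  have hpB : ‖p m‖ ≤ B :=
    (Finset.single_le_sum (f := fun i => ‖p i‖) (fun _ _ => norm_nonneg _) hmM).trans hB
  set L := ∑ i ∈ (Finset.range M).erase m, κ / |ξ i| with hLdef
  have hL0 : 0 ≤ L := Finset.sum_nonneg fun _ _ => by positivity
  have hset : (Finset.range M).erase m = Finset.range m ∪ Finset.Ioo m M := by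
    ext i; simp; omega
  have hdisj : Disjoint (Finset.range m) (Finset.Ioo m M) := by
    rw [Finset.disjoint_left]; intro i; simp; omega
  have hLle : ∑ i ∈ Finset.range m, κ / |ξ i| ≤ L := by
    rw [hLdef, hset, Finset.sum_union hdisj]
    exact le_add_of_nonneg_right (Finset.sum_nonneg fun _ _ => by positivity)
  have ht : ∑ i ∈ Finset.range M, ‖t i‖ ≤ L + 2 * R := by
    rw [← Finset.add_sum_erase _ _ hmM]
    have : ∑ i ∈ (Finset.range M).erase m, ‖t i‖ ≤ ∑ i ∈ (Finset.range M).erase m,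
        (κ / |ξ i| + ‖t i - κ / (Complex.I * ξ i)‖) := by
      refine Finset.sum_le_sum fun i _ => ?_
      have h1 := norm_sub_norm_le (t i) (κ / (Complex.I * ξ i))
      have h2 : ‖(κ / (Complex.I * ξ i) : ℂ)‖ = κ / |ξ i| := by
        rw [norm_div, norm_mul, Complex.norm_I, one_mul, Complex.norm_real, Complex.norm_real,
          Real.norm_eq_abs, Real.norm_eq_abs, abs_of_nonneg hκ]
      linarith
    rw [Finset.sum_add_distrib] at this
    linarith
  set W := ∑ i ∈ Finset.range m, t i + ∑ i ∈ Finset.Ioo m M, star (t i) with hW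
  set W₀ := ∑ i ∈ Finset.range m, (κ / (Complex.I * ξ i) : ℂ) +
    ∑ i ∈ Finset.Ioo m M, star (κ / (Complex.I * ξ i) : ℂ) with hW₀
  -- For `i < m` the term is `-I κ/|ξ i|` directly. For `i > m` the sign of `ξ i` is reversed, and
  -- conjugation reverses it back.
  have e : W₀ = -Complex.I * (L : ℂ) := by
    rw [hLdef, hset, Finset.sum_union hdisj, hW₀]
    push_cast
    rw [mul_add, Finset.mul_sum, Finset.mul_sum]
    congr 1
    · refine Finset.sum_congr rfl fun i hi => ?_
      rw [abs_of_pos (hξ i (Finset.mem_range.1 hi)), ← div_div, ← mul_div_assoc, Complex.div_I]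
      ring
    · refine Finset.sum_congr rfl fun i hi => ?_
      rw [abs_of_neg (hξ' i (Finset.mem_Ioo.1 hi).1), ← div_div, Complex.div_I]
      simp [div_eq_mul_inv, inv_neg]
      ring
  have hWW : ‖W - W₀‖ ≤ R := by
    have : W - W₀ = ∑ i ∈ Finset.range m, (t i - κ / (Complex.I * ξ i)) +
        ∑ i ∈ Finset.Ioo m M, star (t i - κ / (Complex.I * ξ i)) := by
      simp only [hW, hW₀, star_sub, Finset.sum_sub_distrib]
      ring
    rw [this]
    refine (norm_add_le _ _).trans (le_trans (add_le_add (norm_sum_le _ _) (norm_sum_le _ _)) ?_)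
    simp only [norm_star]
    rw [← Finset.sum_union hdisj, ← hset]
    exact hR
  have hWL : L - R ≤ ‖W‖ := by
    have h1 : ‖W₀‖ = L := by
      rw [e, norm_mul, norm_neg, Complex.norm_I, one_mul, Complex.norm_real, Real.norm_eq_abs,
        abs_of_nonneg hL0]
    have h2 := norm_sub_norm_le W₀ W
    rw [norm_sub_rev] at h2
    linarith
  have h1 := h.norm_S_sub_le hm hB hε ht
  rw [← hW] at h1
  have h2 := norm_sub_norm_le (p m * W) (S M)
  rw [norm_sub_rev, norm_mul] at h2
  have h3 : c * L - B * R ≤ ‖p m‖ * ‖W‖ := by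
    have := mul_le_mul_of_nonneg_left hWL (norm_nonneg (p m))
    nlinarith
  -- From `ε ≤ c/4` come `2εL ≤ (c/2)L` and `4εR ≤ cR`, while `c ≤ ‖p m‖ ≤ B`. The logarithmic error
  -- thus takes at most half of the main term `cL`.
  have h4 : 2 * ε * (L + 2 * R) ≤ c / 2 * L + B * R := by nlinarith
  have h5 : c / 2 * ∑ i ∈ Finset.range m, κ / |ξ i| ≤ c / 2 * L := by
    have : 0 ≤ c / 2 := by linarith
    gcongr
  linarith

end IsIteratedSum

/-! ### Quantitative properties and existence of bumps -/

namespace IsBump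

variable {φ : ℝ → ℝ}

theorem eq_zero (hφ : IsBump φ) {x : ℝ} (hx : 1 / 4 < |x|) : φ x = 0 := by
  by_contra h
  have := hφ.support_subset h
  rw [Set.mem_Icc, ← abs_le] at this
  linarith

theorem tsupport_subset (hφ : IsBump φ) : tsupport φ ⊆ Set.Icc (-(1 / 4)) (1 / 4) :=
  closure_minimal hφ.support_subset isClosed_Icc

theorem hasCompactSupport (hφ : IsBump φ) : HasCompactSupport φ :=
  isCompact_Icc.of_isClosed_subset (isClosed_tsupport φ) hφ.tsupport_subset

theorem exists_isProfile (hφ : IsBump φ) : ∃ D, IsProfile φ D := by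
  have h1 : ContDiff ℝ 1 (deriv φ) := by
    have : ContDiff ℝ (1 + 1) φ := hφ.smooth.of_le (by norm_cast)
    exact (contDiff_succ_iff_deriv.1 this).2.2
  obtain ⟨D₀, hD₀⟩ := hφ.smooth.continuous.bounded_above_of_compact_support hφ.hasCompactSupport
  obtain ⟨D₁, hD₁⟩ := h1.continuous.bounded_above_of_compact_support hφ.hasCompactSupport.deriv
  obtain ⟨D₂, hD₂⟩ := (h1.continuous_deriv le_rfl).bounded_above_of_compact_support
    hφ.hasCompactSupport.deriv.deriv
  refine ⟨max (max D₀ D₁) (max D₂ 1), hφ.smooth.of_le (by norm_cast), by simp,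
    hφ.eq_zero (by norm_num [abs_of_pos]), hφ.eq_zero (by norm_num [abs_of_pos]), ?_,
    fun s => (hD₀ s).trans (by simp), fun s => (hD₁ s).trans (by simp),
    fun s => (hD₂ s).trans (by simp)⟩
  by_contra h
  have := hφ.tsupport_subset (support_deriv_subset h)
  norm_num at this

theorem oscPrimitive_right (hφ : IsBump φ) (ξ : ℝ) :
    oscPrimitive φ ξ (1 / 2) = fourierTwo φ (-ξ) := by
  rw [oscPrimitive, intervalIntegral.integral_of_le (by norm_num), fourierTwo,
    setIntegral_eq_integral_of_forall_compl_eq_zero]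
  · refine integral_congr_ae (Filter.Eventually.of_forall fun x => ?_)
    simp [osc]
  · intro x hx
    have : 1 / 4 < |x| := by
      by_contra! h
      rw [abs_le] at h
      exact hx ⟨by linarith [h.1], by linarith [h.2]⟩
    simp [hφ.eq_zero this]

/-- The integral over the block is the transform of `φ` at `-ξ`. Continuity and compactness turn its
nonvanishing on `[-1, 1]` into a uniform lower bound. -/
theorem exists_le_norm_oscPrimitive (hφ : IsBump φ) :
    ∃ c > 0, ∀ ξ, |ξ| ≤ 1 → c ≤ ‖oscPrimitive φ ξ (1 / 2)‖ := by
  have hc : Continuous fun ξ => ‖oscPrimitive φ ξ (1 / 2)‖ := by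
    refine continuous_norm.comp
      (intervalIntegral.continuous_parametric_intervalIntegral_of_continuous' ?_ _ _)
    have := hφ.smooth.continuous
    simp only [osc, Function.uncurry_def]
    fun_prop
  obtain ⟨ξ₀, hξ₀, hmin⟩ := (isCompact_Icc (a := (-1 : ℝ)) (b := 1)).exists_isMinOn
    ⟨0, by norm_num⟩ hc.continuousOn
  refine ⟨‖oscPrimitive φ ξ₀ (1 / 2)‖, ?_, fun ξ hξ => hmin (abs_le.1 hξ)⟩
  rw [gt_iff_lt, norm_pos_iff, hφ.oscPrimitive_right]
  exact hφ.fourier_ne_zero _ ⟨by linarith [hξ₀.2], by linarith [hξ₀.1]⟩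

/-- The factor 8 is chosen so that the main term `mass / (8iξ)` becomes `κ / (iξ)`. -/
theorem mass_right (hφ : IsBump φ) :
    ∃ κ : ℝ, 0 < κ ∧ mass φ (1 / 2) = ((8 * κ : ℝ) : ℂ) := by
  refine ⟨(∫ s in (-1 / 2 : ℝ)..(1 / 2), φ s ^ 2) / 8, ?_, ?_⟩
  · have hne : ∃ x, φ x ≠ 0 := by
      by_contra! h
      have := hφ.integral_eq_one
      simp [h] at this
    obtain ⟨x, hx⟩ := hne
    have hxm := hφ.support_subset hx
    have hc : Continuous fun s => φ s ^ 2 := hφ.smooth.continuous.pow 2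
    have := intervalIntegral.integral_pos (a := -1 / 2) (b := 1 / 2) (by norm_num) hc.continuousOn
      (fun s _ => sq_nonneg _) ⟨x, ⟨by linarith [hxm.1], by linarith [hxm.2]⟩, by positivity⟩
    linarith
  · rw [mass, intervalIntegral.integral_ofReal]
    congr 1
    ring

end IsBump

/-- For a nonnegative normalized bump supported in `[-1/4, 1/4]` and `|ξ| ≤ 1`, the phase satisfies
`|2ξx| ≤ 1/2`. The real part of the transform is therefore at least `cos 1 > 0`. -/
theorem exists_isBump : ∃ φ : ℝ → ℝ, IsBump φ := by
  let f : ContDiffBump (0 : ℝ) := ⟨1 / 8, 1 / 4, by norm_num, by norm_num⟩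
  have hs : Function.support (f.normed volume) ⊆ Set.Icc (-(1 / 4)) (1 / 4) := by
    rw [f.support_normed_eq, Real.ball_eq_Ioo]
    simpa [f] using Set.Ioo_subset_Icc_self
  refine ⟨f.normed volume, f.contDiff_normed, hs, f.integral_normed, fun ξ hξ h => ?_⟩
  have hint : Integrable (fun x : ℝ =>
      Complex.exp (-2 * Complex.I * (ξ : ℂ) * (x : ℂ)) * (f.normed volume x : ℂ)) := by
    refine f.integrable_normed.ofReal.bdd_mul (c := 1)
      (Continuous.aestronglyMeasurable (by fun_prop)) (Filter.Eventually.of_forall fun x => ?_)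
    rw [show -2 * Complex.I * (ξ : ℂ) * (x : ℂ) = ((-2 * ξ * x : ℝ) : ℂ) * Complex.I by
      push_cast; ring, Complex.norm_exp_ofReal_mul_I]
  have hre : (fourierTwo (f.normed volume) ξ).re =
      ∫ x, Real.cos (2 * ξ * x) * f.normed volume x := by
    rw [fourierTwo]
    refine (integral_re hint).symm.trans ?_
    refine integral_congr_ae (Filter.Eventually.of_forall fun x => ?_)
    simp only
    rw [show -2 * Complex.I * (ξ : ℂ) * (x : ℂ) = ((-2 * ξ * x : ℝ) : ℂ) * Complex.I by
      push_cast; ring, RCLike.re_eq_complex_re, Complex.re_mul_ofReal, Complex.exp_ofReal_mul_I_re,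
      show -2 * ξ * x = -(2 * ξ * x) by ring, Real.cos_neg]
  have hlow : Real.cos 1 * ∫ x, f.normed volume x ≤
      ∫ x, Real.cos (2 * ξ * x) * f.normed volume x := by
    rw [← integral_const_mul]
    refine integral_mono (f.integrable_normed.const_mul _) ?_ fun x => ?_
    · refine f.integrable_normed.bdd_mul (c := 1)
        (Continuous.aestronglyMeasurable (by fun_prop)) (Filter.Eventually.of_forall fun x => ?_)
      exact Real.abs_cos_le_one _
    · by_cases hx : f.normed volume x = 0
      · simp [hx]
      · have hx' := hs hx
        refine mul_le_mul_of_nonneg_right ?_ (f.nonneg_normed x)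
        rw [← Real.cos_abs (2 * ξ * x)]
        refine Real.cos_le_cos_of_nonneg_of_le_pi (abs_nonneg _) (by linarith [Real.pi_gt_three]) ?_
        rw [abs_mul, abs_mul, abs_two]
        have h1 : |ξ| ≤ 1 := abs_le.2 hξ
        have h2 : |x| ≤ 1 / 4 := abs_le.2 hx'
        nlinarith [abs_nonneg ξ, abs_nonneg x]
  rw [f.integral_normed, mul_one, ← hre, h] at hlow
  exact absurd hlow (not_le.2 (by simpa using Real.cos_one_pos))

/-! ### Support, size and block structure of the chirp -/

section Chirp

variable {φ : ℝ → ℝ} {A : ℝ} {N : ℕ}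

theorem chirp_of_mem (hφ : IsBump φ) {j : ℕ} (hj : j ∈ Finset.Icc N (2 * N)) {x : ℝ}
    (hx : |x / N - j| ≤ 1 / 2) :
    chirp φ A N x = (N : ℝ)⁻¹ * Real.cos (2 * (A * j / N) * x) * φ (x / N - j) := by
  rw [chirp]
  refine Finset.sum_eq_single j (fun i _ hij => ?_) (fun h => absurd hj h)
  rw [hφ.eq_zero, mul_zero]
  have h1 : (1 : ℝ) ≤ |(i : ℝ) - j| := by
    have : (1 : ℤ) ≤ |(i : ℤ) - j| := Int.one_le_abs (by omega)
    exact_mod_cast this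
  have h2 : |(i : ℝ) - j| ≤ |x / N - j| + |x / N - i| := by
    rw [show (i : ℝ) - j = (x / N - j) - (x / N - i) by ring]
    exact abs_sub _ _
  linarith

theorem chirp_eq_zero (hφ : IsBump φ) {x : ℝ}
    (hx : ∀ j ∈ Finset.Icc N (2 * N), 1 / 4 < |x / N - j|) : chirp φ A N x = 0 :=
  Finset.sum_eq_zero fun j hj => by rw [hφ.eq_zero (hx j hj), mul_zero]

theorem chirp_eq_zero_left (hφ : IsBump φ) (hN : 0 < N) {x : ℝ}
    (hx : x < N * (N - 1 / 4)) : chirp φ A N x = 0 := by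
  refine chirp_eq_zero hφ fun j hj => ?_
  have hN' : (0 : ℝ) < N := by exact_mod_cast hN
  have hj' : (N : ℝ) ≤ j := by exact_mod_cast (Finset.mem_Icc.1 hj).1
  have : x / N < N - 1 / 4 := by rw [div_lt_iff₀ hN']; linarith
  rw [abs_of_neg (by linarith)]
  linarith

theorem chirp_eq_zero_right (hφ : IsBump φ) (hN : 0 < N) {x : ℝ}
    (hx : N * (2 * N + 1 / 4) < x) : chirp φ A N x = 0 := by
  refine chirp_eq_zero hφ fun j hj => ?_
  have hN' : (0 : ℝ) < N := by exact_mod_cast hN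
  have hj' : (j : ℝ) ≤ 2 * N := by exact_mod_cast (Finset.mem_Icc.1 hj).2
  have : 2 * N + 1 / 4 < x / N := by rw [lt_div_iff₀ hN']; linarith
  rw [abs_of_pos (by linarith)]
  linarith

theorem support_chirp_subset (hφ : IsBump φ) (hN : 0 < N) :
    Function.support (chirp φ A N) ⊆ Set.Icc (N * (N - 1 / 4) : ℝ) (N * (2 * N + 1 / 4)) :=
  fun _ hx => ⟨not_lt.1 fun h => hx (chirp_eq_zero_left hφ hN h),
    not_lt.1 fun h => hx (chirp_eq_zero_right hφ hN h)⟩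

theorem tsupport_chirp_subset (hφ : IsBump φ) (hN : 0 < N) :
    tsupport (chirp φ A N) ⊆ Set.Icc (N * (N - 1 / 4) : ℝ) (N * (2 * N + 1 / 4)) :=
  closure_minimal (support_chirp_subset hφ hN) isClosed_Icc

theorem hasCompactSupport_chirp (hφ : IsBump φ) (hN : 0 < N) :
    HasCompactSupport (chirp φ A N) :=
  isCompact_Icc.of_isClosed_subset (isClosed_tsupport _) (tsupport_chirp_subset hφ hN)

theorem tsupport_chirp_subset_Ioi (hφ : IsBump φ) (hN : 0 < N) :
    tsupport (chirp φ A N) ⊆ Set.Ioi 0 := by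
  refine (tsupport_chirp_subset hφ hN).trans fun x hx => ?_
  have hN' : (1 : ℝ) ≤ N := by exact_mod_cast hN
  exact lt_of_lt_of_le (by nlinarith) hx.1

theorem contDiff_chirp (hφ : IsBump φ) : ContDiff ℝ ∞ (chirp φ A N) := by
  unfold chirp
  refine ContDiff.sum fun j _ => ContDiff.mul (contDiff_const.mul ?_) ?_
  · exact Real.contDiff_cos.comp (contDiff_const.mul contDiff_id)
  · exact hφ.smooth.comp ((contDiff_id.div_const _).sub contDiff_const)

theorem abs_chirp_le (hφ : IsBump φ) {D : ℝ} (hD : ∀ s, |φ s| ≤ D) (hN : 0 < N) (x : ℝ) :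
    |chirp φ A N x| ≤ D / N := by
  have hD0 : 0 ≤ D := (abs_nonneg _).trans (hD 0)
  by_cases h : ∃ j ∈ Finset.Icc N (2 * N), |x / N - j| ≤ 1 / 2
  · obtain ⟨j, hj, hx⟩ := h
    rw [chirp_of_mem hφ hj hx, abs_mul, abs_mul, abs_inv, Nat.abs_cast]
    calc _ ≤ (N : ℝ)⁻¹ * 1 * D := by
          gcongr
          · exact Real.abs_cos_le_one _
          · exact hD _
      _ = D / N := by ring
  · push Not at h
    rw [chirp_eq_zero hφ fun j hj => by linarith [h j hj], abs_zero]
    positivity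

/-- The pieces have disjoint supports, so the height is at most `D/N`. The support lies in an
interval of length `N² + N/2 ≤ (2N)²`, hence the factor `2D`. -/
theorem eLpNorm_chirp_le (hφ : IsBump φ) {D : ℝ} (hD : ∀ s, |φ s| ≤ D) (hN : 0 < N) :
    eLpNorm (chirp φ A N) 2 volume ≤ ENNReal.ofReal (2 * D) := by
  have hD0 : 0 ≤ D := (abs_nonneg _).trans (hD 0)
  have hN' : (1 : ℝ) ≤ N := by exact_mod_cast hN
  set I := Set.Icc (N * (N - 1 / 4) : ℝ) (N * (2 * N + 1 / 4)) with hI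
  have h1 : eLpNorm (chirp φ A N) 2 volume ≤ eLpNorm (I.indicator fun _ => D / N) 2 volume := by
    refine eLpNorm_mono_real fun x => ?_
    by_cases hx : x ∈ I
    · rw [Set.indicator_of_mem hx]
      exact abs_chirp_le hφ hD hN x
    · rw [Set.indicator_of_notMem hx]
      have : chirp φ A N x = 0 := by
        by_contra h
        exact hx (support_chirp_subset hφ hN h)
      simp [this]
  refine h1.trans ?_
  rw [eLpNorm_indicator_const measurableSet_Icc (by norm_num) (by norm_num), Real.volume_Icc,
    Real.enorm_eq_ofReal (by positivity)]
  have h2 : ENNReal.ofReal (N * (2 * N + 1 / 4) - N * (N - 1 / 4)) ^ (1 / (2 : ENNReal).toReal) ≤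
      ENNReal.ofReal (2 * N) := by
    rw [ENNReal.ofReal_rpow_of_nonneg (by nlinarith) (by norm_num)]
    refine ENNReal.ofReal_le_ofReal ?_
    rw [ENNReal.toReal_ofNat, ← Real.sqrt_eq_rpow, Real.sqrt_le_left (by positivity)]
    nlinarith
  calc _ ≤ ENNReal.ofReal (D / N) * ENNReal.ofReal (2 * N) := by gcongr
    _ = ENNReal.ofReal (2 * D) := by
      rw [← ENNReal.ofReal_mul (by positivity)]
      congr 1
      field_simp

/-- After rescaling, the modulated chirp is a two-frequency block on each unit interval. -/
theorem modulate_chirp_affine (hφ : IsBump φ) (hN : 0 < N) {i : ℕ} (hi : i ≤ N) (k : ℝ) {s : ℝ}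
    (hs : s ∈ Set.Icc (-1 / 2 : ℝ) (1 / 2)) :
    ((N : ℝ) : ℂ) * modulate k (chirp φ A N) (N * s + N * (N + i)) =
      block φ (1 / 2 * osc (N * k - A * (N + i)) (N + i))
        (1 / 2 * osc (N * k + A * (N + i)) (N + i))
        (N * k - A * (N + i)) (N * k + A * (N + i)) s := by
  have hN' : (N : ℝ) ≠ 0 := by exact_mod_cast hN.ne'
  have hx : (N * s + N * (N + i)) / N - ((N + i : ℕ) : ℝ) = s := by
    push_cast; field_simp; ring
  have hmem : N + i ∈ Finset.Icc N (2 * N) := by simp; omega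
  rw [modulate, chirp_of_mem hφ hmem (by rw [hx, abs_le]; constructor <;> linarith [hs.1, hs.2]),
    hx, block]
  have hcos : 2 * (A * ((N + i : ℕ) : ℝ) / N) * (N * s + N * (N + i)) =
      2 * (A * (N + i)) * (s + (N + i)) := by
    push_cast; field_simp
  rw [hcos]
  push_cast
  rw [Complex.cos]
  have hN'' : (N : ℂ) ≠ 0 := by exact_mod_cast hN.ne'
  -- The cosine is split into two exponentials. The lower one combines with the modulation into the
  -- detuned frequency `Nk - A(N+i)`, the upper one into `Nk + A(N+i)`.
  have e1 : Complex.exp (2 * Complex.I * k * (N * s + N * (N + i))) *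
      Complex.exp (-(2 * (A * (N + i)) * (s + (N + i))) * Complex.I) =
      osc (N * k - A * (N + i)) (N + i) * osc (N * k - A * (N + i)) s := by
    rw [osc, osc, ← Complex.exp_add, ← Complex.exp_add]
    congr 1
    push_cast
    ring
  have e2 : Complex.exp (2 * Complex.I * k * (N * s + N * (N + i))) *
      Complex.exp ((2 * (A * (N + i)) * (s + (N + i))) * Complex.I) =
      osc (N * k + A * (N + i)) (N + i) * osc (N * k + A * (N + i)) s := by
    rw [osc, osc, ← Complex.exp_add, ← Complex.exp_add]
    congr 1
    push_cast
    ring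
  have e3 : (N : ℂ) * (N : ℂ)⁻¹ = 1 := mul_inv_cancel₀ hN''
  linear_combination (1 / 2 * (φ s : ℂ)) * (e1 + e2) +
    (Complex.exp (2 * Complex.I * k * (N * s + N * (N + i))) *
      (Complex.exp ((2 * (A * (N + i)) * (s + (N + i))) * Complex.I) +
      Complex.exp (-(2 * (A * (N + i)) * (s + (N + i))) * Complex.I)) / 2 * φ s) * e3

end Chirp

/-! ### Chen's recursion along nodes, and two elementary sums -/

theorem iterTwo_congr {f f' g g' : ℝ → ℂ} {a x : ℝ} (hax : a ≤ x)
    (hf : ∀ t ∈ Set.Icc a x, f t = f' t) (hg : ∀ t ∈ Set.Icc a x, g t = g' t) :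
    iterTwo f g a x = iterTwo f' g' a x := by
  refine intervalIntegral.integral_congr fun t ht => ?_
  rw [Set.uIcc_of_le hax] at ht
  rw [hg t ht, intervalIntegral.integral_congr fun s hs => hf s ?_]
  rw [Set.uIcc_of_le ht.1] at hs
  exact ⟨hs.1, hs.2.trans ht.2⟩

theorem iterThree_congr {f f' g g' h h' : ℝ → ℂ} {a x : ℝ} (hax : a ≤ x)
    (hf : ∀ t ∈ Set.Icc a x, f t = f' t) (hg : ∀ t ∈ Set.Icc a x, g t = g' t)
    (hh : ∀ t ∈ Set.Icc a x, h t = h' t) :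
    iterThree f g h a x = iterThree f' g' h' a x := by
  refine intervalIntegral.integral_congr fun t ht => ?_
  rw [Set.uIcc_of_le hax] at ht
  rw [hh t ht, iterTwo_congr ht.1 (fun s hs => hf s ⟨hs.1, hs.2.trans ht.2⟩)
    (fun s hs => hg s ⟨hs.1, hs.2.trans ht.2⟩)]

/-- Chen's identity at each node. When the first variable lies before the node, the last two give an
integral of `star f` then `f`, which is the conjugate of the second order block integral. This is
the source of `star (t i)`. -/
theorem isIteratedSum_of_continuous {f : ℝ → ℂ} (hf : Continuous f) (X : ℕ → ℝ) :
    IsIteratedSum (fun i => ∫ t in X i..X (i + 1), f t)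
      (fun i => iterTwo f (fun t => star (f t)) (X i) (X (i + 1)))
      (fun i => iterThree f (fun t => star (f t)) f (X i) (X (i + 1)))
      (fun i => ∫ t in X 0..X i, f t)
      (fun i => iterTwo f (fun t => star (f t)) (X 0) (X i))
      (fun i => iterThree f (fun t => star (f t)) f (X 0) (X i)) where
  P_zero := by simp
  Q_zero := by simp [iterTwo]
  S_zero := by simp [iterThree]
  P_succ i := (intervalIntegral.integral_add_adjacent_intervals (hf.intervalIntegrable _ _)
    (hf.intervalIntegrable _ _)).symm
  Q_succ i := by
    have hg : Continuous fun t => star (f t) := continuous_star.comp hf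
    rw [iterTwo_chen hf hg (X 0) (X i) (X (i + 1)), ← integral_star]
  S_succ i := by
    have hg : Continuous fun t => star (f t) := continuous_star.comp hf
    rw [iterThree_chen hf hg hf (X 0) (X i) (X (i + 1)), ← iterTwo_star]
    simp only [star_star]

/-- Shifting the sum into `ℤ` makes the bound independent of `m`; the term `i = m` is zero by the
convention for division. -/
theorem exists_sum_inv_sq_le : ∃ Z : ℝ, 0 ≤ Z ∧ ∀ (m : ℕ) (s : Finset ℕ),
    ∑ i ∈ s, 1 / ((i : ℝ) - m) ^ 2 ≤ Z := by
  have hs : Summable fun n : ℤ => 1 / (n : ℝ) ^ 2 := Real.summable_one_div_int_pow.2 one_lt_two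
  refine ⟨∑' n : ℤ, 1 / (n : ℝ) ^ 2, tsum_nonneg fun n => by positivity, fun m s => ?_⟩
  have hinj : Set.InjOn (fun i : ℕ => (i : ℤ) - m) s := fun i _ j _ h => by
    simp only at h; omega
  have := hs.sum_le_tsum (s.image fun i : ℕ => (i : ℤ) - m) fun n _ => by positivity
  rw [Finset.sum_image hinj] at this
  simpa using this

theorem log_le_sum_inv (m : ℕ) : Real.log (m + 1) ≤ ∑ i ∈ Finset.range m, 1 / ((m : ℝ) - i) := by
  have h1 := log_add_one_le_harmonic m
  rw [harmonic, Rat.cast_sum, ← Finset.sum_range_reflect] at h1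
  push_cast at h1
  refine h1.trans (Finset.sum_le_sum fun i hi => le_of_eq ?_)
  have hi := Finset.mem_range.1 hi
  have : ((m - 1 - i : ℕ) : ℝ) + 1 = m - i := by
    rw [← Nat.cast_sub hi.le, ← Nat.cast_succ]
    congr 1
    omega
  rw [this, one_div]

/-! ### Size and sign of the detunings near a resonance -/

section Resonance

variable {A k : ℝ} {N m : ℕ}

/-- The frequency of the `i`-th block of the chirp relative to `k`, after rescaling. -/
noncomputable def detuning (A k : ℝ) (N i : ℕ) : ℝ := N * k - A * (N + i)

theorem detuning_eq (A k : ℝ) (N m i : ℕ) :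
    detuning A k N i = detuning A k N m - A * ((i : ℝ) - m) := by
  unfold detuning; ring

theorem one_le_abs_sub_of_ne {i m : ℕ} (h : i ≠ m) : (1 : ℝ) ≤ |(i : ℝ) - m| := by
  have : (1 : ℤ) ≤ |(i : ℤ) - m| := Int.one_le_abs (by omega)
  exact_mod_cast this

theorem le_abs_detuning (hA : 2 ≤ A) (hk : |detuning A k N m| ≤ 1) {i : ℕ} (hi : i ≠ m) :
    A * |(i : ℝ) - m| / 2 ≤ |detuning A k N i| := by
  have h1 := one_le_abs_sub_of_ne hi
  rw [detuning_eq A k N m i]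
  have h2 := abs_sub_abs_le_abs_sub (A * ((i : ℝ) - m)) (detuning A k N m)
  rw [abs_mul, abs_of_nonneg (by linarith : 0 ≤ A), abs_sub_comm (A * _)] at h2
  nlinarith

theorem abs_detuning_le (hA : 2 ≤ A) (hk : |detuning A k N m| ≤ 1) {i : ℕ} (hi : i ≠ m) :
    |detuning A k N i| ≤ 2 * A * |(i : ℝ) - m| := by
  have h1 := one_le_abs_sub_of_ne hi
  rw [detuning_eq A k N m i]
  have h2 := abs_sub (detuning A k N m) (A * ((i : ℝ) - m))
  rw [abs_mul, abs_of_nonneg (by linarith : 0 ≤ A)] at h2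
  nlinarith

theorem detuning_pos (hA : 2 ≤ A) (hk : |detuning A k N m| ≤ 1) {i : ℕ} (hi : i < m) :
    0 < detuning A k N i := by
  rw [detuning_eq A k N m i]
  have h1 : (i : ℝ) + 1 ≤ m := by exact_mod_cast hi
  have := (abs_le.1 hk).1
  nlinarith

theorem detuning_neg (hA : 2 ≤ A) (hk : |detuning A k N m| ≤ 1) {i : ℕ} (hi : m < i) :
    detuning A k N i < 0 := by
  rw [detuning_eq A k N m i]
  have h1 : (m : ℝ) + 1 ≤ i := by exact_mod_cast hi
  have := (abs_le.1 hk).2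
  nlinarith

theorem sum_inv_detuning_sq_le {Z : ℝ}
    (hZ : ∀ (m : ℕ) (s : Finset ℕ), ∑ i ∈ s, 1 / ((i : ℝ) - m) ^ 2 ≤ Z) (hA : 2 ≤ A)
    (hk : |detuning A k N m| ≤ 1) {s : Finset ℕ} (hs : m ∉ s) :
    ∑ i ∈ s, 1 / detuning A k N i ^ 2 ≤ 4 * Z / A ^ 2 := by
  have hA0 : 0 < A := by linarith
  calc ∑ i ∈ s, 1 / detuning A k N i ^ 2 ≤ ∑ i ∈ s, 4 / A ^ 2 * (1 / ((i : ℝ) - m) ^ 2) := by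
        refine Finset.sum_le_sum fun i hi => ?_
        have him : i ≠ m := fun h => hs (h ▸ hi)
        have h1 := one_le_abs_sub_of_ne him
        have h2 := le_abs_detuning hA hk him
        rw [← sq_abs (detuning A k N i), ← sq_abs ((i : ℝ) - m)]
        have h3 : 0 < |(i : ℝ) - m| := by linarith
        calc 1 / |detuning A k N i| ^ 2 ≤ 1 / (A * |(i : ℝ) - m| / 2) ^ 2 := by gcongr
          _ = _ := by field_simp; norm_num
    _ = 4 / A ^ 2 * ∑ i ∈ s, 1 / ((i : ℝ) - m) ^ 2 := by rw [Finset.mul_sum]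
    _ ≤ 4 / A ^ 2 * Z := by gcongr; exact hZ m s
    _ = _ := by ring

theorem le_sum_inv_detuning (hA : 2 ≤ A) (hk : |detuning A k N m| ≤ 1) {κ : ℝ} (hκ : 0 ≤ κ) :
    κ / (2 * A) * Real.log (m + 1) ≤ ∑ i ∈ Finset.range m, κ / |detuning A k N i| := by
  have hA0 : 0 < A := by linarith
  calc _ ≤ κ / (2 * A) * ∑ i ∈ Finset.range m, 1 / ((m : ℝ) - i) := by
        gcongr; exact log_le_sum_inv m
    _ = ∑ i ∈ Finset.range m, κ / (2 * A) * (1 / ((m : ℝ) - i)) := by rw [Finset.mul_sum]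
    _ ≤ _ := by
        refine Finset.sum_le_sum fun i hi => ?_
        have him := Finset.mem_range.1 hi
        have h1 : (i : ℝ) + 1 ≤ m := by exact_mod_cast him
        have h2 := abs_detuning_le hA hk him.ne
        have h3 := detuning_pos hA hk him
        rw [abs_sub_comm, abs_of_pos (by linarith : (0 : ℝ) < m - i)] at h2
        have h4 : 0 < |detuning A k N i| := abs_pos.2 h3.ne'
        calc κ / (2 * A) * (1 / ((m : ℝ) - i)) = κ / (2 * A * (m - i)) := by
              rw [div_mul_div_comm, mul_one]
          _ ≤ _ := by gcongr

end Resonance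

/-! ### Block integrals of the modulated chirp -/

section Blocks

variable {φ : ℝ → ℝ} {A k D : ℝ} {N i : ℕ}

/-- The left end point of the `i`-th block interval. -/
noncomputable def node (N i : ℕ) : ℝ := N * (-1 / 2) + N * (N + i)

theorem node_succ (N i : ℕ) : node N (i + 1) = N * (1 / 2) + N * (N + i) := by
  unfold node; push_cast; ring

theorem node_mono (N : ℕ) : Monotone (node N) := fun i j h => by
  have : (i : ℝ) ≤ j := by exact_mod_cast h
  unfold node
  gcongr

/-- The `i`-th block of the modulated chirp, rescaled to the unit interval. -/
noncomputable def chirpBlock (φ : ℝ → ℝ) (A k : ℝ) (N i : ℕ) : ℝ → ℂ :=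
  block φ (1 / 2 * osc (detuning A k N i) (N + i)) (1 / 2 * osc (N * k + A * (N + i)) (N + i))
    (detuning A k N i) (N * k + A * (N + i))

theorem norm_half_mul_osc (ζ s : ℝ) : ‖1 / 2 * osc ζ s‖ = 1 / 2 := by
  rw [norm_mul, norm_osc]; norm_num

theorem integral_modulate_chirp (hφ : IsBump φ) (hN : 0 < N) (hi : i ≤ N) (k : ℝ) :
    ∫ t in node N i..node N (i + 1), modulate k (chirp φ A N) t =
      ∫ s in (-1 / 2 : ℝ)..(1 / 2), chirpBlock φ A k N i s := by
  rw [node_succ, node, integral_affine _ (by exact_mod_cast hN.ne')]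
  refine intervalIntegral.integral_congr fun s hs => ?_
  rw [Set.uIcc_of_le (by norm_num)] at hs
  exact modulate_chirp_affine hφ hN hi k hs

theorem star_modulate_chirp_affine (hφ : IsBump φ) (hN : 0 < N) (hi : i ≤ N) (k : ℝ) {s : ℝ}
    (hs : s ∈ Set.Icc (-1 / 2 : ℝ) (1 / 2)) :
    ((N : ℝ) : ℂ) * star (modulate k (chirp φ A N) (N * s + N * (N + i))) =
      star (chirpBlock φ A k N i s) := by
  rw [chirpBlock, detuning, ← modulate_chirp_affine hφ hN hi k hs, star_mul']
  simp

theorem iterTwo_modulate_chirp (hφ : IsBump φ) (hN : 0 < N) (hi : i ≤ N) (k : ℝ) :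
    iterTwo (modulate k (chirp φ A N)) (fun t => star (modulate k (chirp φ A N) t))
        (node N i) (node N (i + 1)) =
      iterTwo (chirpBlock φ A k N i) (fun s => star (chirpBlock φ A k N i s))
        (-1 / 2) (1 / 2) := by
  rw [node_succ, node, iterTwo_affine _ _ (by exact_mod_cast hN.ne')]
  exact iterTwo_congr (by norm_num) (fun s hs => modulate_chirp_affine hφ hN hi k hs)
    (fun s hs => star_modulate_chirp_affine hφ hN hi k hs)

theorem iterThree_modulate_chirp (hφ : IsBump φ) (hN : 0 < N) (hi : i ≤ N) (k : ℝ) :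
    iterThree (modulate k (chirp φ A N)) (fun t => star (modulate k (chirp φ A N) t))
        (modulate k (chirp φ A N)) (node N i) (node N (i + 1)) =
      iterThree (chirpBlock φ A k N i) (fun s => star (chirpBlock φ A k N i s))
        (chirpBlock φ A k N i) (-1 / 2) (1 / 2) := by
  rw [node_succ, node, iterThree_affine _ _ _ (by exact_mod_cast hN.ne')]
  exact iterThree_congr (by norm_num) (fun s hs => modulate_chirp_affine hφ hN hi k hs)
    (fun s hs => star_modulate_chirp_affine hφ hN hi k hs)
    (fun s hs => modulate_chirp_affine hφ hN hi k hs)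

end Blocks

/-! ### Lower bounds at resonant frequencies -/

set_option maxHeartbeats 1000000 in
/-- Logarithmic lower bounds at the resonant frequencies. -/
theorem exists_log_lower_bound {φ : ℝ → ℝ} (hφ : IsBump φ) :
    ∃ c > 0, ∃ A₀ : ℝ, 2 ≤ A₀ ∧ ∀ A, A₀ ≤ A → ∃ K : ℝ, ∀ N : ℕ, 0 < N → ∀ m ≤ N, ∀ k, A ≤ k →
      |detuning A k N m| ≤ 1 →
        c / A * Real.log (m + 1) - K ≤ ‖T (fun _ : Fin 2 => chirp φ A N) k (node N m)‖ ∧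
        c / A * Real.log (m + 1) - K ≤ ‖TInfty (fun _ : Fin 3 => chirp φ A N) k‖ := by
  obtain ⟨D, hD⟩ := hφ.exists_isProfile
  obtain ⟨c₀, hc₀, hlow⟩ := hφ.exists_le_norm_oscPrimitive
  obtain ⟨κ, hκ, hmass⟩ := hφ.mass_right
  obtain ⟨Z, hZ0, hZ⟩ := exists_sum_inv_sq_le
  have hD1 := hD.one_le
  have hD0 : 0 ≤ D := zero_le_one.trans hD1
  set Y := 4 * Z + 2 with hY
  have hY2 : 2 ≤ Y := by linarith
  -- The entries 1 and `c₀/8` of the minimum serve orders two and three, the latter being half of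
  -- the lower bound `c₀/4` for `‖p m‖`. The factor `κ/2` comes from `|ξ i| ≤ 2A|i - m|`. The
  -- threshold on `A` forces `ε ≤ c₀/16`.
  refine ⟨min 1 (c₀ / 8) * (κ / 2), by positivity, max 2 (16 * D * Y / c₀), le_max_left _ _,
    fun A hA₀ => ?_⟩
  have hA : 2 ≤ A := (le_max_left _ _).trans hA₀
  have hA0 : 0 < A := by linarith
  have hAc : 16 * D * Y ≤ c₀ * A := by
    have := (le_max_right _ _).trans hA₀
    rw [div_le_iff₀ hc₀] at this
    linarith
  have hεc : D * (Y / A ^ 2) ≤ c₀ / 16 := by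
    rw [mul_div_assoc', div_le_div_iff₀ (by positivity) (by norm_num)]
    have : c₀ * A ≤ c₀ * A ^ 2 := by nlinarith [mul_pos hc₀ hA0]
    linarith
  set ε := D * (Y / A ^ 2) with hε
  have hε0 : 0 ≤ ε := by positivity
  set B := D + ε with hB
  set R := D ^ 2 + 2 * D ^ 2 * Y with hR
  set V := D ^ 3 + 3 * D ^ 3 * Y with hV
  refine ⟨2 * B * R + B ^ 3 + V + R + B ^ 2, fun N hN m hm k hk hres => ?_⟩
  have hB0 : 0 ≤ B := by positivity
  have hR0 : 0 ≤ R := by positivity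
  have hV0 : 0 ≤ V := by positivity
  have hN1 : (1 : ℝ) ≤ N := by exact_mod_cast hN
  set F := chirp φ A N with hF
  have hFc : Continuous F := (contDiff_chirp hφ).continuous
  have hFs : HasCompactSupport F := hasCompactSupport_chirp hφ hN
  set f := modulate k F with hf
  have hfc : Continuous f := continuous_modulate k hFc
  have hsum := isIteratedSum_of_continuous hfc (node N)
  set p : ℕ → ℂ := fun i => ∫ t in node N i..node N (i + 1), f t with hp
  set t : ℕ → ℂ := fun i => iterTwo f (fun t => star (f t)) (node N i) (node N (i + 1)) with ht
  set s : ℕ → ℂ := fun i => iterThree f (fun t => star (f t)) f (node N i) (node N (i + 1))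
    with hs
  set ξ : ℕ → ℝ := fun i => detuning A k N i with hξ
  set η : ℕ → ℝ := fun i => N * k + A * (N + i) with hη
  -- There are `N` indices other than `m`, so this bound already makes `∑ 1/|η i|` at most `1/A`,
  -- uniformly in `N`.
  have hηNA : ∀ i, N * A ≤ η i := fun i => by
    have : (N : ℝ) * A ≤ N * k := by gcongr
    have : 0 ≤ A * (N + i : ℝ) := by positivity
    simp only [hη]; linarith
  have hNA : 0 < N * A := by positivity
  have hη0 : ∀ i, 0 < η i := fun i => hNA.trans_le (hηNA i)
  have hξ1 : ∀ i, i ≠ m → 1 ≤ |ξ i| := fun i hi => by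
    have h1 := le_abs_detuning hA hres hi
    have h2 := one_le_abs_sub_of_ne hi
    refine le_trans ?_ h1
    nlinarith
  have hξ0 : ∀ i, i ≠ m → ξ i ≠ 0 := fun i hi =>
    abs_pos.1 (zero_lt_one.trans_le (hξ1 i hi))
  have hmM : m ∈ Finset.range (N + 1) := Finset.mem_range.2 (by omega)
  have hle : ∀ i ∈ (Finset.range (N + 1)).erase m, i ≠ m ∧ i ≤ N := fun i hi => by
    simp at hi; omega
  -- sums of the error terms
  have hsumξ : ∑ i ∈ (Finset.range (N + 1)).erase m, 1 / ξ i ^ 2 ≤ 4 * Z / A ^ 2 :=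
    sum_inv_detuning_sq_le hZ hA hres (by simp)
  have hcard : ∀ b : ℝ, 0 ≤ b → ∑ i ∈ (Finset.range (N + 1)).erase m, b ≤ N * b := fun b hb => by
    rw [Finset.sum_const, Finset.card_erase_of_mem hmM, Finset.card_range, nsmul_eq_mul]
    simp
  have hsumη2 : ∑ i ∈ (Finset.range (N + 1)).erase m, 1 / η i ^ 2 ≤ 2 / A ^ 2 := by
    calc _ ≤ ∑ i ∈ (Finset.range (N + 1)).erase m, 1 / (N * A) ^ 2 := by
          refine Finset.sum_le_sum fun i _ => ?_
          have := hηNA i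
          gcongr
      _ ≤ N * (1 / (N * A) ^ 2) := hcard _ (by positivity)
      _ = 1 / N * (1 / A ^ 2) := by field_simp
      _ ≤ 1 * (1 / A ^ 2) := by
          gcongr
          rw [div_le_one (by positivity)]; exact hN1
      _ ≤ _ := by rw [one_mul]; gcongr; norm_num
  have hsumη : ∑ i ∈ (Finset.range (N + 1)).erase m, 1 / |η i| ≤ 2 / A := by
    calc _ ≤ ∑ i ∈ (Finset.range (N + 1)).erase m, 1 / (N * A) := by
          refine Finset.sum_le_sum fun i _ => ?_
          have := hηNA i
          rw [abs_of_pos (hη0 i)]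
          gcongr
      _ ≤ N * (1 / (N * A)) := hcard _ (by positivity)
      _ = 1 / A := by field_simp
      _ ≤ _ := by gcongr; norm_num
  have hsum1 : ∑ i ∈ (Finset.range (N + 1)).erase m, (1 / ξ i ^ 2 + 1 / η i ^ 2) ≤ Y / A ^ 2 := by
    rw [Finset.sum_add_distrib, hY, add_div]
    linarith
  have hsum2 : ∑ i ∈ (Finset.range (N + 1)).erase m, (1 / ξ i ^ 2 + 1 / |η i|) ≤ Y := by
    rw [Finset.sum_add_distrib]
    have h1 : 4 * Z / A ^ 2 ≤ 4 * Z := div_le_self (by positivity) (by nlinarith)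
    have h2 : 2 / A ≤ 2 := div_le_self (by norm_num) (by linarith)
    linarith
  -- bounds for the blocks
  have hhalf := norm_half_mul_osc
  have hpε : ∑ i ∈ (Finset.range (N + 1)).erase m, ‖p i‖ ≤ ε := by
    calc _ ≤ ∑ i ∈ (Finset.range (N + 1)).erase m, D * (1 / ξ i ^ 2 + 1 / η i ^ 2) := by
          refine Finset.sum_le_sum fun i hi => ?_
          obtain ⟨him, hiN⟩ := hle i hi
          simp only [hp, hf, hF]
          rw [integral_modulate_chirp hφ hN hiN]
          exact norm_integral_block_right_le hD (hhalf _ _) (hhalf _ _) (hξ0 i him) (hη0 i).ne'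
      _ ≤ ε := by
          rw [← Finset.mul_sum, hε]
          gcongr
  have hpm : ‖p m‖ ≤ D := by
    simp only [hp, hf, hF]
    rw [integral_modulate_chirp hφ hN hm]
    exact norm_integral_block_le hD (hhalf _ _) (hhalf _ _) _ _ (by norm_num)
  have hpB : ∑ i ∈ Finset.range (N + 1), ‖p i‖ ≤ B := by
    rw [← Finset.add_sum_erase _ _ hmM]
    exact add_le_add hpm hpε
  -- The resonant half contributes at least `c₀/2` and the frequency `η m` removes at most `c₀/32`.
  have hpc : c₀ / 4 ≤ ‖p m‖ := by
    simp only [hp, hf, hF]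
    rw [integral_modulate_chirp hφ hN hm, chirpBlock, integral_block hφ.smooth.continuous]
    have h1 := hlow (ξ m) hres
    have h2 := hD.norm_primitive_right_le (hη0 m).ne'
    have h3 : D / η m ^ 2 ≤ c₀ / 16 := by
      refine le_trans ?_ hεc
      rw [hε, mul_div_assoc']
      have h4 : A ≤ η m := le_trans (by nlinarith) (hηNA m)
      have h5 : D * 1 ≤ D * Y := by gcongr; linarith
      rw [mul_one] at h5
      gcongr
    have h4 := norm_sub_le_norm_add (1 / 2 * osc (ξ m) (N + m) * oscPrimitive φ (ξ m) (1 / 2))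
      (1 / 2 * osc (η m) (N + m) * oscPrimitive φ (η m) (1 / 2))
    rw [norm_mul, hhalf, norm_mul, hhalf] at h4
    refine le_trans ?_ h4
    linarith
  have htR : ∑ i ∈ (Finset.range (N + 1)).erase m, ‖t i - κ / (Complex.I * ξ i)‖ ≤ R := by
    calc _ ≤ ∑ i ∈ (Finset.range (N + 1)).erase m, 2 * D ^ 2 * (1 / ξ i ^ 2 + 1 / |η i|) := by
          refine Finset.sum_le_sum fun i hi => ?_
          obtain ⟨him, hiN⟩ := hle i hi
          simp only [ht, hf, hF]
          rw [iterTwo_modulate_chirp hφ hN hiN]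
          have h1 := norm_iterTwo_block_sub_le hD (hhalf (ξ i) (N + i)) (hhalf (η i) (N + i))
            (hξ0 i him) (hη0 i).ne' (u := 1 / 2) (by norm_num)
          rw [hmass] at h1
          have hne : (ξ i : ℂ) ≠ 0 := by exact_mod_cast hξ0 i him
          have h2 : (1 / (8 * Complex.I * ξ i) * ((8 * κ : ℝ) : ℂ) : ℂ) =
              κ / (Complex.I * ξ i) := by
            push_cast
            field_simp
          rw [h2] at h1
          exact h1
      _ ≤ 2 * D ^ 2 * Y := by
          rw [← Finset.mul_sum]
          gcongr
      _ ≤ R := by rw [hR]; linarith [sq_nonneg D]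
  have htm : ‖t m‖ ≤ R := by
    simp only [ht, hf, hF]
    rw [iterTwo_modulate_chirp hφ hN hm]
    refine (norm_iterTwo_block_le hD (hhalf _ _) (hhalf _ _) _ _ (by norm_num)).trans ?_
    rw [hR]
    have : 0 ≤ 2 * D ^ 2 * Y := by positivity
    linarith
  have hsV : ∑ i ∈ Finset.range (N + 1), ‖s i‖ ≤ V := by
    rw [← Finset.add_sum_erase _ _ hmM]
    refine add_le_add ?_ ?_
    · simp only [hs, hf, hF]
      rw [iterThree_modulate_chirp hφ hN hm]
      exact norm_iterThree_block_le hD (hhalf _ _) (hhalf _ _) _ _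
    · calc _ ≤ ∑ i ∈ (Finset.range (N + 1)).erase m, 3 * D ^ 3 * (1 / ξ i ^ 2 + 1 / |η i|) := by
            refine Finset.sum_le_sum fun i hi => ?_
            obtain ⟨him, hiN⟩ := hle i hi
            simp only [hs, hf, hF]
            rw [iterThree_modulate_chirp hφ hN hiN]
            exact norm_iterThree_block_le_div hD (hhalf _ _) (hhalf _ _) (hξ1 i him) (hη0 i).ne'
        _ ≤ 3 * D ^ 3 * Y := by
            rw [← Finset.mul_sum]
            gcongr
  -- the two lower bounds
  have hlog : 0 ≤ Real.log (m + 1) := Real.log_nonneg (by linarith [m.cast_nonneg (α := ℝ)])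
  have hL := le_sum_inv_detuning hA hres hκ.le
  have hleft : ∀ x ≤ node N 0, F x = 0 := fun x hx => by
    refine chirp_eq_zero_left hφ hN (hx.trans_lt ?_)
    simp only [node, Nat.cast_zero, add_zero]
    nlinarith
  have hright : ∀ x, node N (N + 1) ≤ x → F x = 0 := fun x hx => by
    refine chirp_eq_zero_right hφ hN (lt_of_lt_of_le ?_ hx)
    rw [node_succ]
    nlinarith
  have hlogA : ∀ b, min 1 (c₀ / 8) ≤ b → min 1 (c₀ / 8) * (κ / 2) / A * Real.log (m + 1) ≤
      b * ∑ i ∈ Finset.range m, κ / |ξ i| := fun b hb => by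
    have hmin : 0 ≤ min 1 (c₀ / 8) := by positivity
    calc _ = min 1 (c₀ / 8) * (κ / (2 * A) * Real.log (m + 1)) := by field_simp
      _ ≤ b * ∑ i ∈ Finset.range m, κ / |ξ i| := by gcongr; exact hmin.trans hb
  have hBR : 0 ≤ 2 * B * R + B ^ 3 + V := by positivity
  have hRB : 0 ≤ R + B ^ 2 := by positivity
  constructor
  · rw [T_two_eq hFc hFs hleft (node_mono N (Nat.zero_le m))]
    have h1 := hsum.le_norm_Q (κ := κ) (R := R) (ξ := ξ) (M := N + 1) (by omega : m ≤ N + 1)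
      (fun i hi => detuning_pos hA hres hi) hpB
      (le_trans (Finset.sum_le_sum_of_subset_of_nonneg (fun i hi => by
        simp at hi ⊢; omega) fun _ _ _ => norm_nonneg _) htR)
    have h2 := hlogA 1 (min_le_left _ _)
    rw [one_mul] at h2
    linarith
  · rw [TInfty_eq_T (fun _ => hright), T_three_eq hFc hFs hleft (node_mono N (Nat.zero_le _))]
    have h1 := hsum.le_norm_S (κ := κ) (R := R) (ξ := ξ) (M := N + 1) (by omega : m < N + 1) hκ.le
      (fun i hi => detuning_pos hA hres hi) (fun i hi => detuning_neg hA hres hi) hpB hpε hpc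
      (by linarith) htR htm hsV
    have h2 := hlogA (c₀ / 4 / 2) ((min_le_right _ _).trans (by linarith))
    linarith

/-! ### Measure of the resonant set and failure of the weak-type bounds -/

/-- The resonant frequencies fill a fixed portion of `[A, 2A]`. -/
theorem le_volume_of_resonant {A : ℝ} (hA : 2 < A) {N : ℕ} (hN : 2 ≤ N) {p : ℝ → Prop}
    (hp : ∀ m, N ≤ 2 * m → m < N → ∀ k, A ≤ k → |detuning A k N m| ≤ 1 → p k) :
    1 / 4 ≤ volume {k : ℝ | k ∈ Set.Icc A (2 * A) ∧ p k} := by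
  have hN' : (2 : ℝ) ≤ N := by exact_mod_cast hN
  have hN0 : (0 : ℝ) < N := by linarith
  set I : ℕ → Set ℝ := fun m => Set.Icc ((A * (N + m) - 1) / N) ((A * (N + m) + 1) / N) with hI
  -- The range gives `N ≤ 2m`, keeps the intervals inside `[A, 2A]` since `1 ≤ m < N`, and has at
  -- least `(N-1)/2` elements. With lengths `2/N` the total is at least `(N-1)/N ≥ 1/2`.
  set s := Finset.Ico ((N + 1) / 2) N with hs
  have hsub : (⋃ m ∈ s, I m) ⊆ {k : ℝ | k ∈ Set.Icc A (2 * A) ∧ p k} := by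
    intro k hk
    simp only [Set.mem_iUnion, hI, Set.mem_Icc, hs, Finset.mem_Ico] at hk
    obtain ⟨m, ⟨hm1, hm2⟩, hk1, hk2⟩ := hk
    rw [div_le_iff₀ hN0] at hk1
    rw [le_div_iff₀ hN0] at hk2
    have hm1' : (1 : ℝ) ≤ m := by exact_mod_cast (by omega : 1 ≤ m)
    have hm2' : (m : ℝ) + 1 ≤ N := by exact_mod_cast hm2
    have hAk : A ≤ k := by
      have : A * N ≤ k * N := by nlinarith
      exact le_of_mul_le_mul_right this hN0
    refine ⟨⟨hAk, ?_⟩, hp m (by omega) hm2 k hAk ?_⟩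
    · have : k * N ≤ 2 * A * N := by nlinarith
      exact le_of_mul_le_mul_right this hN0
    · rw [detuning, abs_le]
      constructor <;> linarith
  -- The centres are at least `A/N` apart and the half-widths are `1/N`, so the strict inequality `2
  -- < A` separates the intervals.
  have hdisj : Set.PairwiseDisjoint (s : Set ℕ) I := by
    intro i _ j _ hij
    rw [Function.onFun, Set.disjoint_left]
    intro k hi hj
    have h1 := one_le_abs_sub_of_ne hij
    simp only [hI, Set.mem_Icc, div_le_iff₀ hN0, le_div_iff₀ hN0] at hi hj
    have h2 : A * |(i : ℝ) - j| ≤ 2 := by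
      rw [show A * |(i : ℝ) - j| = |A * ((i : ℝ) - j)| by
        rw [abs_mul, abs_of_nonneg (by linarith : 0 ≤ A)], abs_le]
      constructor <;> linarith [hi.1, hi.2, hj.1, hj.2]
    nlinarith
  refine le_trans ?_ (measure_mono hsub)
  rw [measure_biUnion_finset hdisj fun m _ => measurableSet_Icc]
  have hvol : ∀ m ∈ s, volume (I m) = ENNReal.ofReal (2 / N) := fun m _ => by
    rw [hI]
    simp only [Real.volume_Icc]
    congr 1
    ring
  rw [Finset.sum_congr rfl hvol, Finset.sum_const, nsmul_eq_mul, ← ENNReal.ofReal_natCast,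
    ← ENNReal.ofReal_mul (Nat.cast_nonneg _), hs, Nat.card_Ico,
    show (1 / 4 : ENNReal) = ENNReal.ofReal (1 / 4) by
      rw [ENNReal.ofReal_div_of_pos (by norm_num)]; simp]
  refine ENNReal.ofReal_le_ofReal ?_
  have hcard : (N : ℝ) - 1 ≤ 2 * ((N - (N + 1) / 2 : ℕ) : ℝ) := by
    have : N ≤ 2 * (N - (N + 1) / 2) + 1 := by omega
    have : (N : ℝ) ≤ 2 * ((N - (N + 1) / 2 : ℕ) : ℝ) + 1 := by exact_mod_cast this
    linarith
  rw [mul_div_assoc', div_le_div_iff₀ (by norm_num) hN0]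
  linarith

theorem chirp_log_divergence {φ : ℝ → ℝ} (hφ : IsBump φ) :
    ∃ A₀ : ℝ, ∀ A : ℝ, A₀ ≤ A →
      ∃ c : ℝ, 0 < c ∧ ∃ C : NNReal, ∃ N₀ : ℕ, ∀ N : ℕ, N₀ ≤ N →
        eLpNorm (chirp φ A N) 2 volume ≤ (C : ENNReal) ∧
        1 / 4 ≤ volume {k : ℝ | k ∈ Set.Icc A (2 * A) ∧
          ENNReal.ofReal (c * Real.log (N : ℝ)) ≤ maximalT 2 (chirp φ A N) k} ∧
        1 / 4 ≤ volume {k : ℝ | k ∈ Set.Icc A (2 * A) ∧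
          c * Real.log (N : ℝ) ≤ ‖TInfty (fun _ : Fin 3 => chirp φ A N) k‖} := by
  obtain ⟨D, hD⟩ := hφ.exists_isProfile
  obtain ⟨c, hc, A₀, hA₀, hmain⟩ := exists_log_lower_bound hφ
  refine ⟨A₀ + 1, fun A hA => ?_⟩
  obtain ⟨K, hK⟩ := hmain A (by linarith)
  have hA2 : 2 < A := by linarith
  have hA0 : 0 < A := by linarith
  have hcA : 0 < c / A := by positivity
  have htend : Filter.Tendsto (fun N : ℕ => c / A / 2 * Real.log N) Filter.atTop Filter.atTop :=
    (Real.tendsto_log_atTop.comp tendsto_natCast_atTop_atTop).const_mul_atTop (by positivity)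
  obtain ⟨N₁, hN₁⟩ := Filter.eventually_atTop.1
    (htend.eventually_ge_atTop (K + c / A * Real.log 2))
  refine ⟨c / A / 2, by positivity, (2 * D).toNNReal, max N₁ 2, fun N hN => ?_⟩
  have hN2 : 2 ≤ N := (le_max_right _ _).trans hN
  have hN0 : (0 : ℝ) < N := by exact_mod_cast (by omega : 0 < N)
  -- Halving the coefficient of the logarithm absorbs both `K` and the loss `log 2` from `m ≥ N/2`.
  have hlog : ∀ m : ℕ, N ≤ 2 * m → c / A / 2 * Real.log N ≤ c / A * Real.log (m + 1) - K := by
    intro m hm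
    have h1 := hN₁ N ((le_max_left _ _).trans hN)
    have h2 : Real.log N ≤ Real.log (m + 1) + Real.log 2 := by
      rw [← Real.log_mul (by positivity) (by norm_num)]
      refine Real.log_le_log hN0 ?_
      have : (N : ℝ) ≤ 2 * m := by exact_mod_cast hm
      linarith
    nlinarith
  refine ⟨eLpNorm_chirp_le hφ hD.bound (by omega), ?_, ?_⟩
  · refine le_volume_of_resonant hA2 hN2 fun m hm hmN k hk hres => ?_
    have h := (hlog m hm).trans (hK N (by omega) m hmN.le k hk hres).1
    refine le_trans ?_ (le_iSup (fun x => ‖T (fun _ : Fin 2 => chirp φ A N) k x‖ₑ) (node N m))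
    rw [← ofReal_norm]
    exact ENNReal.ofReal_le_ofReal h
  · exact le_volume_of_resonant hA2 hN2 fun m hm hmN k hk hres =>
      (hlog m hm).trans (hK N (by omega) m hmN.le k hk hres).2

theorem le_weakNorm {q : ℝ} {g : ℝ → ENNReal} {t : NNReal} {v : ENNReal}
    (hq : 0 ≤ q) (h : v ≤ volume {k : ℝ | (t : ENNReal) < g k}) :
    (t : ENNReal) * v ^ (1 / q) ≤ weakNorm q g :=
  le_trans (by gcongr) (le_iSup (fun t : NNReal =>
    (t : ENNReal) * volume {k : ℝ | (t : ENNReal) < g k} ^ (1 / q)) t)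

/-- A weak-type bound is incompatible with a family of test functions, bounded in `L²`, on which
the operator exceeds arbitrarily large levels on sets of measure at least `1/4`. -/
theorem not_weak_bound {q : ℝ} (hq : 0 ≤ q) (n : ℕ) {S : (ℝ → ℝ) → ℝ → ENNReal} {F : ℕ → ℝ → ℝ}
    {C₀ : NNReal} {N₀ : ℕ} {c : ℝ} (hc : 0 < c) (hF : ∀ N, N₀ ≤ N → ContDiff ℝ ∞ (F N) ∧
      HasCompactSupport (F N) ∧ tsupport (F N) ⊆ Set.Ioi 0 ∧
      eLpNorm (F N) 2 volume ≤ C₀ ∧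
      1 / 4 ≤ volume {k : ℝ | ENNReal.ofReal (c * Real.log N) ≤ S (F N) k}) :
    ¬ ∃ C : NNReal, ∀ F : ℝ → ℝ, ContDiff ℝ ∞ F → HasCompactSupport F →
        tsupport F ⊆ Set.Ioi 0 →
        weakNorm q (S F) ≤ (C : ENNReal) * eLpNorm F 2 volume ^ n := by
  rintro ⟨C, hC⟩
  set δ : NNReal := (1 / 4 : NNReal) ^ (1 / q) with hδ
  have hδ0 : 0 < δ := NNReal.rpow_pos (by norm_num)
  -- This level makes `t δ` exceed the supposed bound by exactly 1.
  set t : NNReal := (C * C₀ ^ n + 1) / δ with ht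
  have htend : Filter.Tendsto (fun N : ℕ => c * Real.log N) Filter.atTop Filter.atTop :=
    (Real.tendsto_log_atTop.comp tendsto_natCast_atTop_atTop).const_mul_atTop hc
  obtain ⟨N, hN, hlog⟩ := ((Filter.eventually_ge_atTop N₀).and
    (htend.eventually_gt_atTop (t : ℝ))).exists
  obtain ⟨h1, h2, h3, h4, h5⟩ := hF N hN
  have h6 : (1 / 4 : ENNReal) ≤ volume {k : ℝ | (t : ENNReal) < S (F N) k} := by
    refine h5.trans (measure_mono fun k hk => ?_)
    refine lt_of_lt_of_le (b := ENNReal.ofReal (c * Real.log N)) ?_ hk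
    rw [← ENNReal.ofReal_coe_nnreal]
    exact (ENNReal.ofReal_lt_ofReal_iff (t.2.trans_lt hlog)).2 hlog
  have h7 := (le_weakNorm hq h6).trans (hC (F N) h1 h2 h3)
  have h8 : (t : ENNReal) * (1 / 4) ^ (1 / q) ≤ (C * C₀ ^ n : NNReal) := by
    refine h7.trans ?_
    push_cast
    gcongr
  have h9 : ((1 / 4 : ENNReal) ^ (1 / q)) = (δ : ENNReal) := by
    rw [hδ, ENNReal.coe_rpow_of_ne_zero (by norm_num)]
    congr 1
    rw [ENNReal.coe_div (by norm_num)]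
    simp
  rw [h9, ← ENNReal.coe_mul, ENNReal.coe_le_coe, ht, div_mul_cancel₀ _ hδ0.ne'] at h8
  exact absurd h8 (not_le.2 (lt_add_one _))

end ChristKiselev

theorem theorem1 :
    -- the maximal estimate with `p = 2`, `n = 2` fails
    (¬ ∃ C : NNReal, ∀ F : ℝ → ℝ, ContDiff ℝ ∞ F → HasCompactSupport F →
        tsupport F ⊆ Set.Ioi 0 →
        ChristKiselev.weakNorm 1 (ChristKiselev.maximalT 2 F)
          ≤ (C : ENNReal) * eLpNorm F 2 volume ^ 2) ∧
    -- the non-maximal estimate with `p = 2`, `n = 3` fails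
    (¬ ∃ C : NNReal, ∀ F : ℝ → ℝ, ContDiff ℝ ∞ F → HasCompactSupport F →
        tsupport F ⊆ Set.Ioi 0 →
        ChristKiselev.weakNorm (2 / 3)
            (fun k => ‖ChristKiselev.TInfty (fun _ : Fin 3 => F) k‖ₑ)
          ≤ (C : ENNReal) * eLpNorm F 2 volume ^ 3) ∧
    -- the logarithmic divergence along the chirps
    (∃ φ : ℝ → ℝ, ChristKiselev.IsBump φ) ∧
    (∀ φ : ℝ → ℝ, ChristKiselev.IsBump φ →
      ∃ A₀ : ℝ, ∀ A : ℝ, A₀ ≤ A →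
        ∃ c : ℝ, 0 < c ∧ ∃ C : NNReal, ∃ N₀ : ℕ, ∀ N : ℕ, N₀ ≤ N →
          eLpNorm (ChristKiselev.chirp φ A N) 2 volume ≤ (C : ENNReal) ∧
          1 / 4 ≤ volume {k : ℝ | k ∈ Set.Icc A (2 * A) ∧
            ENNReal.ofReal (c * Real.log (N : ℝ)) ≤
              ChristKiselev.maximalT 2 (ChristKiselev.chirp φ A N) k} ∧
          1 / 4 ≤ volume {k : ℝ | k ∈ Set.Icc A (2 * A) ∧
            c * Real.log (N : ℝ) ≤
              ‖ChristKiselev.TInfty (fun _ : Fin 3 => ChristKiselev.chirp φ A N) k‖}) := by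
  obtain ⟨φ, hφ⟩ := ChristKiselev.exists_isBump
  obtain ⟨A, hA⟩ := ChristKiselev.chirp_log_divergence hφ
  obtain ⟨c, hc, C₀, N₀, h⟩ := hA A le_rfl
  refine ⟨?_, ?_, ⟨φ, hφ⟩, fun φ hφ => ChristKiselev.chirp_log_divergence hφ⟩
  · refine ChristKiselev.not_weak_bound (S := ChristKiselev.maximalT 2) (C₀ := C₀)
      (F := fun N => ChristKiselev.chirp φ A N) (N₀ := max N₀ 1) zero_le_one 2 hc fun N hN => ?_
    have hN0 : 0 < N := (le_max_right N₀ 1).trans hN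
    obtain ⟨h1, h2, -⟩ := h N ((le_max_left _ _).trans hN)
    exact ⟨ChristKiselev.contDiff_chirp hφ, ChristKiselev.hasCompactSupport_chirp hφ hN0,
      ChristKiselev.tsupport_chirp_subset_Ioi hφ hN0, h1,
      h2.trans (measure_mono fun k hk => hk.2)⟩
  · refine ChristKiselev.not_weak_bound
      (S := fun F k => ‖ChristKiselev.TInfty (fun _ : Fin 3 => F) k‖ₑ) (C₀ := C₀)
      (F := fun N => ChristKiselev.chirp φ A N) (N₀ := max N₀ 1) (by norm_num) 3 hc
      fun N hN => ?_
    have hN0 : 0 < N := (le_max_right N₀ 1).trans hN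
    obtain ⟨h1, -, h3⟩ := h N ((le_max_left _ _).trans hN)
    refine ⟨ChristKiselev.contDiff_chirp hφ, ChristKiselev.hasCompactSupport_chirp hφ hN0,
      ChristKiselev.tsupport_chirp_subset_Ioi hφ hN0, h1,
      h3.trans (measure_mono fun k hk => ?_)⟩
    rw [Set.mem_ofPred_eq, ← ofReal_norm]
    exact ENNReal.ofReal_le_ofReal hk.2
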